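/- Let $\alpha\in\mathbb{C}\setminus\{0,-1\}$ and let $\mathfrak g=D(2,1,\alpha)$ be the contragredient Lie superalgebra over $\mathbb C$ with Cartan matrix $$A=\begin{pmatrix}0&1&\alpha\\1&0&-\alpha-1\\ \alpha&-\alpha-1&0\end{pmatrix},$$ Cartan subalgebra $\mathfrak h$, simple roots $\beta_1,\beta_2,\beta_3$ (all odd) and Chevalley generators $e_i\in\mathfrak g_{\beta_i}$, $f_i\in\mathfrak g_{-\beta_i}$, $h_i=[e_i,f_i]\in\mathfrak h$, with $[h_i,e_j]=a_{ij}e_j$. The corresponding positive roots are $\Delta^+=\Delta^+_{\bar 0}\cup\Delta^+_{\bar 1}$ with $$\Delta_{\bar 0}^+=\{\beta_1+\beta_2,\ \beta_1+\beta_3,\ \beta_2+\beta_3\},\qquad \Delta_{\bar 1}^+=\{\beta_1,\ \beta_2,\ \beta_3,\ \beta_1+\beta_2+\beta_3\},$$ and $\Delta_{\bar 0}^-=-\Delta_{\bar 0}^+$. Put $\alpha_1=\beta_2+\beta_3$, $\alpha_2=\beta_1+\beta_3$, $\alpha_3=\beta_1+\beta_2$, and let $(E_i,F_i,H_i)$ be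 an $\mathfrak{sl}_2$-triple with $E_i\in\mathfrak g_{\alpha_i}$, $F_i\in\mathfrak g_{-\alpha_i}$, $H_i=[E_i,F_i]$, $\alpha_i(H_i)=2$. For $\lambda\in\mathfrak h^*$ let $L(\lambda)$ be the unique simple quotient of the Verma module $M(\lambda)$ of highest weight $\lambda$ with respect to $\Delta^+$, let $\lambda_i=\lambda(h_i)$ and $c_i=\lambda(H_i)$, and let $\operatorname{inj}L(\lambda)$ be the set of even roots $\gamma$ such that the nonzero elements of $\mathfrak g_\gamma$ act injectively on $L(\lambda)$. Then for every $\lambda\in\mathfrak h^*$ $$c_1=\frac{\lambda_2+\lambda_3}{-\alpha-1},\qquad c_2=\frac{\lambda_1+\lambda_3}{\alpha},\qquad c_3=\lambda_1+\lambda_2,$$ and $\operatorname{inj}L(\lambda)=\Delta_{\bar 0}^-$ if and only if $c_1,c_2,c_3\notin\mathbb Z_{\ge 1}$ and at most one of $\lambda_1,\lambda_2,\lambda_3$ equals zero. -/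

import Mathlib

/-- A complex Lie superalgebra `g = g₀ ⊕ g₁`, given by the three components of its bracket:
`ee = [·,·] : g₀ × g₀ → g₀`, `eo = [·,·] : g₀ × g₁ → g₁` and `oo = [·,·] : g₁ × g₁ → g₀`
(the remaining component is `[y, x] = -[x, y]` for `y ∈ g₁`, `x ∈ g₀`), subject to super
skew-symmetry and the super Jacobi identity. -/
structure LieSuperalgebra (g₀ g₁ : Type*) [AddCommGroup g₀] [Module ℂ g₀]
    [AddCommGroup g₁] [Module ℂ g₁] where
  ee : g₀ →ₗ[ℂ] g₀ →ₗ[ℂ] g₀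
  eo : g₀ →ₗ[ℂ] g₁ →ₗ[ℂ] g₁
  oo : g₁ →ₗ[ℂ] g₁ →ₗ[ℂ] g₀
  ee_self : ∀ x, ee x x = 0
  oo_symm : ∀ v w, oo v w = oo w v
  jacobi_eee : ∀ x y z, ee x (ee y z) = ee (ee x y) z + ee y (ee x z)
  jacobi_eeo : ∀ x y v, eo x (eo y v) = eo (ee x y) v + eo y (eo x v)
  jacobi_eoo : ∀ x v w, ee x (oo v w) = oo (eo x v) w + oo v (eo x w)
  jacobi_ooo : ∀ u v w, eo (oo u v) w + eo (oo v w) u + eo (oo w u) v = 0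

namespace LieSuperalgebra

variable {g₀ g₁ : Type*} [AddCommGroup g₀] [Module ℂ g₀] [AddCommGroup g₁] [Module ℂ g₁]

/-- The defining relations `x y - (-1)^{|x||y|} y x = [x, y]` of the enveloping algebra. -/
inductive EnvRel (S : LieSuperalgebra g₀ g₁) :
    TensorAlgebra ℂ (g₀ × g₁) → TensorAlgebra ℂ (g₀ × g₁) → Prop
  | ee (x y : g₀) : EnvRel S
      (TensorAlgebra.ι ℂ (x, (0 : g₁)) * TensorAlgebra.ι ℂ (y, (0 : g₁))
        - TensorAlgebra.ι ℂ (y, (0 : g₁)) * TensorAlgebra.ι ℂ (x, (0 : g₁)))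
      (TensorAlgebra.ι ℂ (S.ee x y, (0 : g₁)))
  | eo (x : g₀) (v : g₁) : EnvRel S
      (TensorAlgebra.ι ℂ (x, (0 : g₁)) * TensorAlgebra.ι ℂ ((0 : g₀), v)
        - TensorAlgebra.ι ℂ ((0 : g₀), v) * TensorAlgebra.ι ℂ (x, (0 : g₁)))
      (TensorAlgebra.ι ℂ ((0 : g₀), S.eo x v))
  | oo (v w : g₁) : EnvRel S
      (TensorAlgebra.ι ℂ ((0 : g₀), v) * TensorAlgebra.ι ℂ ((0 : g₀), w)
        + TensorAlgebra.ι ℂ ((0 : g₀), w) * TensorAlgebra.ι ℂ ((0 : g₀), v))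
      (TensorAlgebra.ι ℂ (S.oo v w, (0 : g₁)))

/-- The universal enveloping algebra `U(g)`; a `g`-module is a module over it. -/
abbrev Env (S : LieSuperalgebra g₀ g₁) : Type _ := RingQuot (EnvRel S)

/-- The canonical map `g → U(g)`. -/
noncomputable def toEnv (S : LieSuperalgebra g₀ g₁) : g₀ × g₁ →ₗ[ℂ] Env S :=
  (RingQuot.mkAlgHom ℂ (EnvRel S)).toLinearMap ∘ₗ TensorAlgebra.ι ℂ

/-- The canonical map `g₀ → U(g)`. -/
noncomputable def evenι (S : LieSuperalgebra g₀ g₁) : g₀ →ₗ[ℂ] Env S :=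
  toEnv S ∘ₗ LinearMap.inl ℂ g₀ g₁

/-- The canonical map `g₁ → U(g)`. -/
noncomputable def oddι (S : LieSuperalgebra g₀ g₁) : g₁ →ₗ[ℂ] Env S :=
  toEnv S ∘ₗ LinearMap.inr ℂ g₀ g₁

/-- The even part of the root space `g_γ`, relative to a subspace `𝔥` of `g₀`. -/
def evenRootSpace (S : LieSuperalgebra g₀ g₁) (𝔥 : Submodule ℂ g₀) (γ : Module.Dual ℂ 𝔥) :
    Submodule ℂ g₀ where
  carrier := {x | ∀ h : 𝔥, S.ee h x = γ h • x}
  zero_mem' := by intro h; simp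
  add_mem' := by
    intro x y hx hy h
    rw [map_add, hx h, hy h, smul_add]
  smul_mem' := by
    intro c x hx h
    rw [map_smul, hx h, smul_comm]

/-- The odd part of the root space `g_γ`, relative to a subspace `𝔥` of `g₀`. -/
def oddRootSpace (S : LieSuperalgebra g₀ g₁) (𝔥 : Submodule ℂ g₀) (γ : Module.Dual ℂ 𝔥) :
    Submodule ℂ g₁ where
  carrier := {v | ∀ h : 𝔥, S.eo h v = γ h • v}
  zero_mem' := by intro h; simp
  add_mem' := by
    intro x y hx hy h
    rw [map_add, hx h, hy h, smul_add]
  smul_mem' := by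
    intro c x hx h
    rw [map_smul, hx h, smul_comm]

/-- The set `Δ₀` of even roots. -/
def evenRoots (S : LieSuperalgebra g₀ g₁) (𝔥 : Submodule ℂ g₀) : Set (Module.Dual ℂ 𝔥) :=
  {γ | γ ≠ 0 ∧ evenRootSpace S 𝔥 γ ≠ ⊥}

/-- The set `Δ₁` of odd roots. -/
def oddRoots (S : LieSuperalgebra g₀ g₁) (𝔥 : Submodule ℂ g₀) : Set (Module.Dual ℂ 𝔥) :=
  {γ | γ ≠ 0 ∧ oddRootSpace S 𝔥 γ ≠ ⊥}

/-- The left ideal of `U(g)` generated by the root vectors of the positive roots `Δ⁺` (which span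
`n⁺`) and by the elements `h - lam(h)`, `h ∈ 𝔥`. -/
noncomputable def vermaIdeal (S : LieSuperalgebra g₀ g₁) (𝔥 : Submodule ℂ g₀)
    (pos : Set (Module.Dual ℂ 𝔥)) (lam : Module.Dual ℂ 𝔥) : Submodule (Env S) (Env S) :=
  Submodule.span (Env S)
    ({u | ∃ γ ∈ pos, ∃ x ∈ evenRootSpace S 𝔥 γ, u = evenι S x} ∪
     {u | ∃ γ ∈ pos, ∃ v ∈ oddRootSpace S 𝔥 γ, u = oddι S v} ∪
     {u | ∃ h : 𝔥, u = evenι S h - algebraMap ℂ (Env S) (lam h)})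

/-- The Verma module `M(lam)` of highest weight `lam`. -/
abbrev Verma (S : LieSuperalgebra g₀ g₁) (𝔥 : Submodule ℂ g₀)
    (pos : Set (Module.Dual ℂ 𝔥)) (lam : Module.Dual ℂ 𝔥) : Type _ :=
  Env S ⧸ vermaIdeal S 𝔥 pos lam

/-- The sum of all proper submodules of the Verma module: its unique maximal proper submodule. -/
noncomputable def vermaMax (S : LieSuperalgebra g₀ g₁) (𝔥 : Submodule ℂ g₀)
    (pos : Set (Module.Dual ℂ 𝔥)) (lam : Module.Dual ℂ 𝔥) :
    Submodule (Env S) (Verma S 𝔥 pos lam) :=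
  sSup {N | N ≠ ⊤}

/-- The unique simple quotient `L(lam)` of the Verma module `M(lam)`. -/
abbrev SimpleHW (S : LieSuperalgebra g₀ g₁) (𝔥 : Submodule ℂ g₀)
    (pos : Set (Module.Dual ℂ 𝔥)) (lam : Module.Dual ℂ 𝔥) : Type _ :=
  Verma S 𝔥 pos lam ⧸ vermaMax S 𝔥 pos lam

/-- `inj M`: the even roots whose (nonzero) root vectors act injectively on `M`. -/
def inj (S : LieSuperalgebra g₀ g₁) (𝔥 : Submodule ℂ g₀) (M : Type*) [AddCommGroup M]
    [Module (Env S) M] : Set (Module.Dual ℂ 𝔥) :=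
  {γ | γ ∈ evenRoots S 𝔥 ∧
    ∀ x ∈ evenRootSpace S 𝔥 γ, x ≠ 0 → Function.Injective fun m : M => evenι S x • m}

end LieSuperalgebra

namespace D21

/-- The even part `sl₂ × sl₂ × sl₂`. -/
abbrev Even : Type := Fin 3 → LieAlgebra.SpecialLinear.sl (Fin 2) ℂ

/-- The odd part `ℂ² ⊗ ℂ² ⊗ ℂ²`; a tensor is given by its coordinates. -/
abbrev Odd : Type := Fin 2 → Fin 2 → Fin 2 → ℂ

/-- The action of `sl₂ × sl₂ × sl₂` on `ℂ² ⊗ ℂ² ⊗ ℂ²`. -/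
def act (x : Even) (v : Odd) : Odd := fun a b c =>
  ∑ d, ((x 0).1 a d * v d b c + (x 1).1 b d * v a d c + (x 2).1 c d * v a b d)

/-- The matrix of the invariant symplectic form on `ℂ²`. -/
def J : Matrix (Fin 2) (Fin 2) ℂ := !![0, 1; -1, 0]

/-- For pure tensors `v = v₀ ⊗ v₁ ⊗ v₂` and `w = w₀ ⊗ w₁ ⊗ w₂`, `contr v w i` is the matrix of
`vᵢ ⊗ wᵢ`, multiplied by the values of the symplectic form on the two other pairs of factors. -/
def contr (v w : Odd) : Fin 3 → Matrix (Fin 2) (Fin 2) ℂ :=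
  ![Matrix.of fun a a' => ∑ b, ∑ b', ∑ c, ∑ c', J b b' * J c c' * (v a b c * w a' b' c'),
    Matrix.of fun b b' => ∑ a, ∑ a', ∑ c, ∑ c', J a a' * J c c' * (v a b c * w a' b' c'),
    Matrix.of fun c c' => ∑ a, ∑ a', ∑ b, ∑ b', J a a' * J b b' * (v a b c * w a' b' c')]

/-- The parameters of the odd bracket; they add up to zero. -/
def sigma (α : ℂ) : Fin 3 → ℂ := ![-(α + 1), α, 1]

/-- The bracket of two odd elements. -/
def oddBracket (α : ℂ) (v w : Odd) : Even := fun i =>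
  ⟨sigma α i • ((contr v w i + (contr v w i).transpose) * J), by
    change Matrix.trace (sigma α i • ((contr v w i + (contr v w i).transpose) * J)) = 0
    simp [Matrix.trace, Matrix.mul_apply, J, Fin.sum_univ_two]
    ring⟩

theorem trace_zero (x : Even) (i : Fin 3) : (x i).1 1 1 = -(x i).1 0 0 := by
  have h : Matrix.trace (x i).1 = 0 := (x i).2
  rw [Matrix.trace_fin_two] at h
  linear_combination h

theorem add_entry (x y : Even) (i : Fin 3) (a b : Fin 2) :
    ((x + y) i).1 a b = (x i).1 a b + (y i).1 a b := rfl

theorem smul_entry (c : ℂ) (x : Even) (i : Fin 3) (a b : Fin 2) :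
    ((c • x) i).1 a b = c * (x i).1 a b := rfl

theorem even_ext {x y : Even} (h00 : ∀ i, (x i).1 0 0 = (y i).1 0 0)
    (h01 : ∀ i, (x i).1 0 1 = (y i).1 0 1) (h10 : ∀ i, (x i).1 1 0 = (y i).1 1 0) : x = y := by
  funext i
  apply Subtype.ext
  ext a b
  revert a b
  rw [Fin.forall_fin_two]
  constructor <;> rw [Fin.forall_fin_two] <;> constructor
  · exact h00 i
  · exact h01 i
  · exact h10 i
  · rw [trace_zero, trace_zero, h00 i]

theorem odd_ext {v w : Odd} (h : ∀ a b c, v a b c = w a b c) : v = w := by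
  funext a b c
  exact h a b c

theorem contr_zero (v w : Odd) (a a' : Fin 2) : contr v w 0 a a' =
    v a 0 0 * w a' 1 1 - v a 0 1 * w a' 1 0 - v a 1 0 * w a' 0 1 + v a 1 1 * w a' 0 0 := by
  simp [contr, J, Fin.sum_univ_two]
  ring

theorem contr_one (v w : Odd) (b b' : Fin 2) : contr v w 1 b b' =
    v 0 b 0 * w 1 b' 1 - v 0 b 1 * w 1 b' 0 - v 1 b 0 * w 0 b' 1 + v 1 b 1 * w 0 b' 0 := by
  simp [contr, J, Fin.sum_univ_two]
  ring

theorem contr_two (v w : Odd) (c c' : Fin 2) : contr v w 2 c c' =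
    v 0 0 c * w 1 1 c' - v 0 1 c * w 1 0 c' - v 1 0 c * w 0 1 c' + v 1 1 c * w 0 0 c' := by
  simp [contr, J, Fin.sum_univ_two]
  ring

theorem oddBracket_00 (α : ℂ) (v w : Odd) (i : Fin 3) : (oddBracket α v w i).1 0 0 =
    -(sigma α i * (contr v w i 0 1 + contr v w i 1 0)) := by
  simp [oddBracket, J, Matrix.mul_apply, Fin.sum_univ_two]
  ring

theorem oddBracket_01 (α : ℂ) (v w : Odd) (i : Fin 3) : (oddBracket α v w i).1 0 1 =
    2 * sigma α i * contr v w i 0 0 := by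
  simp [oddBracket, J, Matrix.mul_apply, Fin.sum_univ_two]
  ring

theorem oddBracket_10 (α : ℂ) (v w : Odd) (i : Fin 3) : (oddBracket α v w i).1 1 0 =
    -(2 * sigma α i * contr v w i 1 1) := by
  simp [oddBracket, J, Matrix.mul_apply, Fin.sum_univ_two]
  ring

theorem contr_add_left (u v w : Odd) (i : Fin 3) (a b : Fin 2) :
    contr (u + v) w i a b = contr u w i a b + contr v w i a b := by
  fin_cases i <;> simp [contr_zero, contr_one, contr_two] <;> ring

theorem contr_add_right (u v w : Odd) (i : Fin 3) (a b : Fin 2) :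
    contr u (v + w) i a b = contr u v i a b + contr u w i a b := by
  fin_cases i <;> simp [contr_zero, contr_one, contr_two] <;> ring

theorem contr_smul_left (c : ℂ) (v w : Odd) (i : Fin 3) (a b : Fin 2) :
    contr (c • v) w i a b = c * contr v w i a b := by
  fin_cases i <;> simp [contr_zero, contr_one, contr_two] <;> ring

theorem contr_smul_right (c : ℂ) (v w : Odd) (i : Fin 3) (a b : Fin 2) :
    contr v (c • w) i a b = c * contr v w i a b := by
  fin_cases i <;> simp [contr_zero, contr_one, contr_two] <;> ring

theorem contr_symm (v w : Odd) (i : Fin 3) (a b : Fin 2) :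
    contr v w i a b = contr w v i b a := by
  fin_cases i <;> simp [contr_zero, contr_one, contr_two] <;> ring

/-- The bracket of two odd elements, as a bilinear map. -/
def oddBracketₗ (α : ℂ) : Odd →ₗ[ℂ] Odd →ₗ[ℂ] Even :=
  LinearMap.mk₂ ℂ (oddBracket α)
    (by
      intro u v w
      apply even_ext <;> intro i <;>
        simp [oddBracket_00, oddBracket_01, oddBracket_10, contr_add_left] <;> ring)
    (by
      intro c v w
      apply even_ext <;> intro i <;>
        simp [oddBracket_00, oddBracket_01, oddBracket_10, contr_smul_left] <;> ring)
    (by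
      intro u v w
      apply even_ext <;> intro i <;>
        simp [oddBracket_00, oddBracket_01, oddBracket_10, contr_add_right] <;> ring)
    (by
      intro c v w
      apply even_ext <;> intro i <;>
        simp [oddBracket_00, oddBracket_01, oddBracket_10, contr_smul_right] <;> ring)

/-- The action of the even part on the odd part, as a bilinear map. -/
def actₗ : Even →ₗ[ℂ] Odd →ₗ[ℂ] Odd :=
  LinearMap.mk₂ ℂ act
    (by intros; funext a b c; simp [act, Fin.sum_univ_two]; ring)
    (by intros; funext a b c; simp [act, Fin.sum_univ_two]; ring)
    (by intros; funext a b c; simp [act, Fin.sum_univ_two]; ring)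
    (by intros; funext a b c; simp [act, Fin.sum_univ_two]; ring)

/-- The componentwise bracket of `sl₂ × sl₂ × sl₂`, as a bilinear map. -/
def evenBracketₗ : Even →ₗ[ℂ] Even →ₗ[ℂ] Even :=
  LinearMap.mk₂ ℂ (fun x y i => ⁅x i, y i⁆)
    (fun x y z => funext fun i => add_lie (x i) (y i) (z i))
    (fun c x y => funext fun i => smul_lie c (x i) (y i))
    (fun x y z => funext fun i => lie_add (x i) (y i) (z i))
    (fun c x y => funext fun i => lie_smul c (x i) (y i))

theorem evenBracket_apply (x y : Even) (i : Fin 3) (a b : Fin 2) :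
    (evenBracketₗ x y i).1 a b =
      (x i).1 a 0 * (y i).1 0 b + (x i).1 a 1 * (y i).1 1 b
        - ((y i).1 a 0 * (x i).1 0 b + (y i).1 a 1 * (x i).1 1 b) := by
  change (⁅x i, y i⁆ : LieAlgebra.SpecialLinear.sl (Fin 2) ℂ).1 a b = _
  rw [LieAlgebra.SpecialLinear.sl_bracket]
  simp [Matrix.mul_apply, Fin.sum_univ_two]

theorem act_apply (x : Even) (v : Odd) (a b c : Fin 2) : act x v a b c =
    (x 0).1 a 0 * v 0 b c + (x 0).1 a 1 * v 1 b c + (x 1).1 b 0 * v a 0 c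
      + (x 1).1 b 1 * v a 1 c + (x 2).1 c 0 * v a b 0 + (x 2).1 c 1 * v a b 1 := by
  simp [act, Fin.sum_univ_two]
  ring

theorem oddBracket_symm (α : ℂ) (v w : Odd) : oddBracket α v w = oddBracket α w v := by
  apply even_ext <;> intro i
  · rw [oddBracket_00, oddBracket_00, contr_symm v w, contr_symm v w i 1 0, add_comm]
  · rw [oddBracket_01, oddBracket_01, contr_symm v w]
  · rw [oddBracket_10, oddBracket_10, contr_symm v w]

theorem act_lie (x y : Even) (v : Odd) :
    act x (act y v) = act (evenBracketₗ x y) v + act y (act x v) := by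
  apply odd_ext; intro a b c
  simp only [Pi.add_apply, act_apply, evenBracket_apply]
  ring

theorem contr_act (x : Even) (v w : Odd) (i : Fin 3) (a b : Fin 2) :
    contr (act x v) w i a b + contr v (act x w) i a b =
      (x i).1 a 0 * contr v w i 0 b + (x i).1 a 1 * contr v w i 1 b
        + (x i).1 b 0 * contr v w i a 0 + (x i).1 b 1 * contr v w i a 1 := by
  have h0 := trace_zero x 0
  have h1 := trace_zero x 1
  have h2 := trace_zero x 2
  fin_cases i
  · change contr (act x v) w 0 a b + contr v (act x w) 0 a b =
      (x 0).1 a 0 * contr v w 0 0 b + (x 0).1 a 1 * contr v w 0 1 b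
        + (x 0).1 b 0 * contr v w 0 a 0 + (x 0).1 b 1 * contr v w 0 a 1
    simp only [contr_zero, act_apply, h1, h2]
    ring
  · change contr (act x v) w 1 a b + contr v (act x w) 1 a b =
      (x 1).1 a 0 * contr v w 1 0 b + (x 1).1 a 1 * contr v w 1 1 b
        + (x 1).1 b 0 * contr v w 1 a 0 + (x 1).1 b 1 * contr v w 1 a 1
    simp only [contr_one, act_apply, h0, h2]
    ring
  · change contr (act x v) w 2 a b + contr v (act x w) 2 a b =
      (x 2).1 a 0 * contr v w 2 0 b + (x 2).1 a 1 * contr v w 2 1 b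
        + (x 2).1 b 0 * contr v w 2 a 0 + (x 2).1 b 1 * contr v w 2 a 1
    simp only [contr_two, act_apply, h0, h1]
    ring

theorem lie_oddBracket (α : ℂ) (x : Even) (v w : Odd) :
    evenBracketₗ x (oddBracket α v w) =
      oddBracket α (act x v) w + oddBracket α v (act x w) := by
  apply even_ext <;> intro i <;>
    simp only [add_entry, evenBracket_apply, trace_zero, oddBracket_00, oddBracket_01,
      oddBracket_10]
  · have h1 := contr_act x v w i 0 1
    have h2 := contr_act x v w i 1 0
    rw [trace_zero] at h1 h2
    linear_combination sigma α i * (h1 + h2)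
  · have h1 := contr_act x v w i 0 0
    linear_combination -2 * sigma α i * h1
  · have h1 := contr_act x v w i 1 1
    rw [trace_zero] at h1
    linear_combination 2 * sigma α i * h1

theorem act_oddBracket (α : ℂ) (u v w : Odd) :
    act (oddBracket α u v) w + act (oddBracket α v w) u + act (oddBracket α w u) v = 0 := by
  apply odd_ext
  have s0 : sigma α 0 = -(α + 1) := rfl
  have s1 : sigma α 1 = α := rfl
  have s2 : sigma α 2 = 1 := rfl
  simp only [Fin.forall_fin_two]
  refine ⟨⟨⟨?_, ?_⟩, ?_, ?_⟩, ⟨?_, ?_⟩, ?_, ?_⟩ <;>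
  · simp only [Pi.add_apply, Pi.zero_apply, act_apply, trace_zero, oddBracket_00, oddBracket_01,
      oddBracket_10, contr_zero, contr_one, contr_two, s0, s1, s2]
    ring

/-- The Lie superalgebra `D(2,1,α)`, with even part `sl₂ × sl₂ × sl₂` and odd part
`ℂ² ⊗ ℂ² ⊗ ℂ²`. -/
def g (α : ℂ) : LieSuperalgebra Even Odd where
  ee := evenBracketₗ
  eo := actₗ
  oo := oddBracketₗ α
  ee_self x := funext fun i => lie_self (x i)
  oo_symm := oddBracket_symm α
  jacobi_eee x y z := funext fun i => leibniz_lie (x i) (y i) (z i)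
  jacobi_eeo := act_lie
  jacobi_eoo := lie_oddBracket α
  jacobi_ooo := act_oddBracket α

/-- The Cartan subalgebra `𝔥` of diagonal elements. -/
def cartan : Submodule ℂ Even where
  carrier := {x | ∀ i, (x i).1 0 1 = 0 ∧ (x i).1 1 0 = 0}
  zero_mem' := by intro i; simp
  add_mem' := by intro x y hx hy i; simp [hx i, hy i]
  smul_mem' := by intro c x hx i; simp [hx i]

/-- The linear form on `𝔥` that reads off the first diagonal entry of the `i`-th matrix. -/
def eps (i : Fin 3) : Module.Dual ℂ cartan where
  toFun x := (x.1 i).1 0 0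
  map_add' _ _ := rfl
  map_smul' _ _ := rfl

/-- The simple roots `β₁, β₂, β₃`, all of them odd. -/
def beta : Fin 3 → Module.Dual ℂ cartan :=
  ![-eps 0 + eps 1 + eps 2, eps 0 - eps 1 + eps 2, eps 0 + eps 1 - eps 2]

/-- The even roots `α₁ = β₂ + β₃`, `α₂ = β₁ + β₃`, `α₃ = β₁ + β₂`. -/
def evenSimple : Fin 3 → Module.Dual ℂ cartan :=
  ![beta 1 + beta 2, beta 0 + beta 2, beta 0 + beta 1]

/-- `Δ₀⁺`. -/
def evenPos : Set (Module.Dual ℂ cartan) :=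
  {beta 0 + beta 1, beta 0 + beta 2, beta 1 + beta 2}

/-- `Δ₁⁺`. -/
def oddPos : Set (Module.Dual ℂ cartan) :=
  {beta 0, beta 1, beta 2, beta 0 + beta 1 + beta 2}

/-- `Δ⁺`. -/
def pos : Set (Module.Dual ℂ cartan) := evenPos ∪ oddPos

/-- `Δ₀⁻ = -Δ₀⁺`. -/
def evenNeg : Set (Module.Dual ℂ cartan) := {γ | -γ ∈ evenPos}

/-- The pure tensor of the standard basis vectors with indices `a`, `b`, `c`. -/
def tens (a b c : Fin 2) : Odd := fun a' b' c' => if a' = a ∧ b' = b ∧ c' = c then 1 else 0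

/-- The Chevalley generators `e₁, e₂, e₃`. -/
def e : Fin 3 → Odd := ![tens 1 0 0, tens 0 1 0, tens 0 0 1]

/-- The Chevalley generators `f₁, f₂, f₃`. -/
noncomputable def f : Fin 3 → Odd :=
  ![(1 / 2 : ℂ) • tens 0 1 1, (1 / 2 : ℂ) • tens 1 0 1, (1 / 2 : ℂ) • tens 1 1 0]

/-- The Chevalley generators `hᵢ = [eᵢ, fᵢ]` of `𝔥`. -/
noncomputable def h (α : ℂ) (i : Fin 3) : cartan :=
  ⟨(g α).oo (e i) (f i), by
    intro j
    change (oddBracket α (e i) (f i) j).1 0 1 = 0 ∧ (oddBracket α (e i) (f i) j).1 1 0 = 0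
    rw [oddBracket_01, oddBracket_10]
    fin_cases i <;> fin_cases j <;> simp [e, f, tens, contr_zero, contr_one, contr_two]⟩

/-- The root vectors `Eᵢ` of the roots `αᵢ`. -/
def E (i : Fin 3) : Even :=
  Pi.single i ⟨!![0, 1; 0, 0], by
    change Matrix.trace !![(0 : ℂ), 1; 0, 0] = 0
    simp [Matrix.trace_fin_two]⟩

/-- The root vectors `Fᵢ` of the roots `-αᵢ`. -/
def F (i : Fin 3) : Even :=
  Pi.single i ⟨!![0, 0; 1, 0], by
    change Matrix.trace !![(0 : ℂ), 0; 1, 0] = 0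
    simp [Matrix.trace_fin_two]⟩

theorem E_apply (i j : Fin 3) (a b : Fin 2) :
    (E i j).1 a b = if j = i ∧ a = 0 ∧ b = 1 then 1 else 0 := by
  by_cases hij : j = i
  · subst hij
    fin_cases a <;> fin_cases b <;> simp [E]
  · simp [E, hij]

theorem F_apply (i j : Fin 3) (a b : Fin 2) :
    (F i j).1 a b = if j = i ∧ a = 1 ∧ b = 0 then 1 else 0 := by
  by_cases hij : j = i
  · subst hij
    fin_cases a <;> fin_cases b <;> simp [F]
  · simp [F, hij]

/-- `Hᵢ = [Eᵢ, Fᵢ]`, which is the matrix `diag(1, -1)` in the `i`-th factor. -/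
noncomputable def H (α : ℂ) (i : Fin 3) : cartan :=
  ⟨(g α).ee (E i) (F i), by
    intro j
    change (evenBracketₗ (E i) (F i) j).1 0 1 = 0 ∧ (evenBracketₗ (E i) (F i) j).1 1 0 = 0
    simp [evenBracket_apply, E_apply, F_apply]⟩

theorem H_apply (α : ℂ) (i j : Fin 3) (a b : Fin 2) :
    ((H α i).1 j).1 a b = if j = i ∧ a = b then (if a = 0 then 1 else -1) else 0 := by
  change (evenBracketₗ (E i) (F i) j).1 a b = _
  rw [evenBracket_apply]
  by_cases hij : j = i <;> fin_cases a <;> fin_cases b <;> simp [E_apply, F_apply, hij]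

theorem eps_apply (i : Fin 3) (x : cartan) : eps i x = (x.1 i).1 0 0 := rfl

theorem evenSimple_apply (i : Fin 3) (x : cartan) : evenSimple i x = 2 * (x.1 i).1 0 0 := by
  fin_cases i <;> simp [evenSimple, beta, eps_apply] <;> ring

/-- `(Eᵢ, Fᵢ, Hᵢ)` is an `sl₂`-triple of root vectors for `±αᵢ`. -/
theorem sl2_triple (α : ℂ) (i : Fin 3) :
    E i ∈ (g α).evenRootSpace cartan (evenSimple i) ∧
    F i ∈ (g α).evenRootSpace cartan (-evenSimple i) ∧
    (g α).ee (E i) (F i) = H α i ∧ evenSimple i (H α i) = 2 := by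
  refine ⟨?_, ?_, rfl, ?_⟩
  · intro x
    change evenBracketₗ x.1 (E i) = evenSimple i x • E i
    rw [evenSimple_apply]
    have k0 := fun j => (x.2 j).1
    have k1 := fun j => (x.2 j).2
    apply even_ext <;> intro j <;> rw [evenBracket_apply, smul_entry] <;>
      by_cases hij : j = i <;> simp [E_apply, hij, trace_zero, k0, k1]
    ring
  · intro x
    change evenBracketₗ x.1 (F i) = (-evenSimple i x) • F i
    rw [evenSimple_apply]
    have k0 := fun j => (x.2 j).1
    have k1 := fun j => (x.2 j).2
    apply even_ext <;> intro j <;> rw [evenBracket_apply, smul_entry] <;>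
      by_cases hij : j = i <;> simp [F_apply, hij, trace_zero, k0, k1]
    ring
  · rw [evenSimple_apply, H_apply]
    simp

/-- The Cartan matrix. -/
def cartanMatrix (α : ℂ) : Matrix (Fin 3) (Fin 3) ℂ :=
  !![0, 1, α; 1, 0, -α - 1; α, -α - 1, 0]

theorem act_e (x : cartan) (i : Fin 3) : act x.1 (e i) = beta i x • e i := by
  have k0 := x.2 0
  have k1 := x.2 1
  have k2 := x.2 2
  apply odd_ext; intro a b c
  fin_cases i <;> fin_cases a <;> fin_cases b <;> fin_cases c <;>
    simp [act_apply, e, tens, beta, eps_apply, k0, k1, k2, trace_zero] <;> ring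

theorem act_f (x : cartan) (i : Fin 3) : act x.1 (f i) = -(beta i x) • f i := by
  have k0 := x.2 0
  have k1 := x.2 1
  have k2 := x.2 2
  apply odd_ext; intro a b c
  fin_cases i <;> fin_cases a <;> fin_cases b <;> fin_cases c <;>
    simp [act_apply, f, tens, beta, eps_apply, k0, k1, k2, trace_zero] <;> ring

theorem h_entry (α : ℂ) (i j : Fin 3) : ((h α i).1 j).1 0 0 =
    (!![α + 1, α, 1; -(α + 1), -α, 1; -(α + 1), α, -1] : Matrix (Fin 3) (Fin 3) ℂ) i j / 2 := by
  change (oddBracket α (e i) (f i) j).1 0 0 = _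
  rw [oddBracket_00]
  fin_cases i <;> fin_cases j <;>
    simp [e, f, tens, contr_zero, contr_one, contr_two, sigma] <;> ring

theorem beta_h (α : ℂ) (i j : Fin 3) : beta j (h α i) = cartanMatrix α i j := by
  fin_cases i <;> fin_cases j <;>
    simp [beta, eps_apply, h_entry, cartanMatrix] <;> ring

/-- The relations of the Chevalley generators. With `generate` and `ideal_eq_bot` below they say that
`g α`, for `α ≠ 0, -1`, is the contragredient Lie superalgebra of the matrix `cartanMatrix α`. -/
theorem chevalley (α : ℂ) (i j : Fin 3) :
    (g α).eo (h α i) (e j) = cartanMatrix α i j • e j ∧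
    (g α).eo (h α i) (f j) = -cartanMatrix α i j • f j ∧
    (g α).oo (e i) (f j) = if i = j then (h α i : Even) else 0 := by
  refine ⟨?_, ?_, ?_⟩
  · rw [← beta_h]; exact act_e _ _
  · rw [← beta_h]; exact act_f _ _
  · by_cases hij : i = j
    · subst hij
      simp [h]
    · rw [if_neg hij]
      change oddBracket α (e i) (f j) = 0
      apply even_ext <;> intro k
      · rw [oddBracket_00]
        fin_cases i <;> fin_cases j <;> fin_cases k <;>
          simp [e, f, tens, contr_zero, contr_one, contr_two] at hij ⊢
      · rw [oddBracket_01]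
        fin_cases i <;> fin_cases j <;> fin_cases k <;>
          simp [e, f, tens, contr_zero, contr_one, contr_two] at hij ⊢
      · rw [oddBracket_10]
        fin_cases i <;> fin_cases j <;> fin_cases k <;>
          simp [e, f, tens, contr_zero, contr_one, contr_two] at hij ⊢

/-- A graded ideal `I₀ ⊕ I₁` that meets `𝔥` trivially is zero. -/
theorem ideal_eq_bot (α : ℂ) (I₀ : Submodule ℂ Even)
    (I₁ : Submodule ℂ Odd) (hee : ∀ x, ∀ y ∈ I₀, (g α).ee x y ∈ I₀)
    (hoo : ∀ v, ∀ w ∈ I₁, (g α).oo v w ∈ I₀) (hI : I₀ ⊓ cartan = ⊥) : I₀ = ⊥ ∧ I₁ = ⊥ := by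
  have hc : ∀ x ∈ I₀, x ∈ cartan → x = 0 := fun x hx hx' => by
    have : x ∈ I₀ ⊓ cartan := ⟨hx, hx'⟩
    rwa [hI, Submodule.mem_bot] at this
  have key₀ : ∀ x ∈ I₀, x = 0 := by
    intro x hx
    apply hc x hx
    intro i
    constructor
    · have hm := hee (E i) _ (hee (F i) _ (hee (F i) _ hx))
      have hz := hc _ hm (by
        intro j
        change (evenBracketₗ (E i) (evenBracketₗ (F i) (evenBracketₗ (F i) x)) j).1 0 1 = 0 ∧
          (evenBracketₗ (E i) (evenBracketₗ (F i) (evenBracketₗ (F i) x)) j).1 1 0 = 0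
        by_cases hij : j = i <;> simp [evenBracket_apply, E_apply, F_apply, hij])
      have hz' : (evenBracketₗ (E i) (evenBracketₗ (F i) (evenBracketₗ (F i) x)) i).1 0 0 = 0 := by
        change (((g α).ee (E i) ((g α).ee (F i) ((g α).ee (F i) x))) i).1 0 0 = 0
        rw [hz]; rfl
      simp [evenBracket_apply, E_apply, F_apply] at hz'
      linear_combination (-1 / 2) * hz'
    · have hm := hee (F i) _ (hee (E i) _ (hee (E i) _ hx))
      have hz := hc _ hm (by
        intro j
        change (evenBracketₗ (F i) (evenBracketₗ (E i) (evenBracketₗ (E i) x)) j).1 0 1 = 0 ∧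
          (evenBracketₗ (F i) (evenBracketₗ (E i) (evenBracketₗ (E i) x)) j).1 1 0 = 0
        by_cases hij : j = i <;> simp [evenBracket_apply, E_apply, F_apply, hij])
      have hz' : (evenBracketₗ (F i) (evenBracketₗ (E i) (evenBracketₗ (E i) x)) i).1 0 0 = 0 := by
        change (((g α).ee (F i) ((g α).ee (E i) ((g α).ee (E i) x))) i).1 0 0 = 0
        rw [hz]; rfl
      simp [evenBracket_apply, E_apply, F_apply] at hz'
      exact hz'
  refine ⟨(Submodule.eq_bot_iff _).2 key₀, (Submodule.eq_bot_iff _).2 fun v hv => ?_⟩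
  have hz : ∀ w, oddBracket α w v = 0 := fun w => key₀ _ (hoo w v hv)
  have h01 : ∀ w, (oddBracket α w v 2).1 0 1 = 0 := fun w => by rw [hz]; rfl
  have h10 : ∀ w, (oddBracket α w v 2).1 1 0 = 0 := fun w => by rw [hz]; rfl
  simp only [oddBracket_01, oddBracket_10, contr_two] at h01 h10
  apply odd_ext
  simp only [Fin.forall_fin_two]
  refine ⟨⟨⟨?_, ?_⟩, ?_, ?_⟩, ⟨?_, ?_⟩, ?_, ?_⟩
  · simpa [tens, sigma] using h01 (tens 1 1 0)
  · simpa [tens, sigma] using h10 (tens 1 1 1)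
  · simpa [tens, sigma] using h01 (tens 1 0 0)
  · simpa [tens, sigma] using h10 (tens 1 0 1)
  · simpa [tens, sigma] using h01 (tens 0 1 0)
  · simpa [tens, sigma] using h10 (tens 0 1 1)
  · simpa [tens, sigma] using h01 (tens 0 0 0)
  · simpa [tens, sigma] using h10 (tens 0 0 1)

/-- For `α ≠ 0, -1`, the Chevalley generators generate. -/
theorem generate (α : ℂ) (hα₀ : α ≠ 0) (hα₁ : α ≠ -1) (p₀ : Submodule ℂ Even)
    (p₁ : Submodule ℂ Odd) (hee : ∀ x ∈ p₀, ∀ y ∈ p₀, (g α).ee x y ∈ p₀)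
    (heo : ∀ x ∈ p₀, ∀ v ∈ p₁, (g α).eo x v ∈ p₁) (hoo : ∀ v ∈ p₁, ∀ w ∈ p₁, (g α).oo v w ∈ p₀)
    (he : ∀ i, e i ∈ p₁) (hf : ∀ i, f i ∈ p₁) : p₀ = ⊤ ∧ p₁ = ⊤ := by
  have hα₁' : α + 1 ≠ 0 := fun hh => hα₁ (by linear_combination hh)
  have hs : ∀ i, sigma α i ≠ 0 := by
    intro i
    fin_cases i
    · exact neg_ne_zero.2 hα₁'
    · exact hα₀
    · exact one_ne_zero
  have hE : ∀ i, E i ∈ p₀ := by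
    intro i
    have key : (g α).oo (e (i + 1)) (e (i + 2)) = (-2 * sigma α i) • E i := by
      change oddBracket α (e (i + 1)) (e (i + 2)) = _
      apply even_ext <;> intro j <;>
        simp only [oddBracket_00, oddBracket_01, oddBracket_10, smul_entry, E_apply] <;>
        fin_cases i <;> fin_cases j <;>
        simp [e, tens, contr_zero, contr_one, contr_two]
    have hm := hoo _ (he (i + 1)) _ (he (i + 2))
    rw [key] at hm
    exact (Submodule.smul_mem_iff _ (mul_ne_zero (by norm_num) (hs i))).1 hm
  have hF : ∀ i, F i ∈ p₀ := by
    intro i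
    have key : (g α).oo (f (i + 1)) (f (i + 2)) = (sigma α i / 2) • F i := by
      change oddBracket α (f (i + 1)) (f (i + 2)) = _
      apply even_ext <;> intro j <;>
        simp only [oddBracket_00, oddBracket_01, oddBracket_10, smul_entry, F_apply] <;>
        fin_cases i <;> fin_cases j <;>
        simp [f, tens, contr_zero, contr_one, contr_two] <;> ring
    have hm := hoo _ (hf (i + 1)) _ (hf (i + 2))
    rw [key] at hm
    exact (Submodule.smul_mem_iff _ (div_ne_zero (hs i) (by norm_num))).1 hm
  have hH : ∀ i, (H α i : Even) ∈ p₀ := fun i => hee _ (hE i) _ (hF i)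
  constructor
  · rw [eq_top_iff]
    intro x _
    have hx : x = ∑ i, ((x i).1 0 1 • E i + (x i).1 1 0 • F i + (x i).1 0 0 • (H α i : Even)) := by
      rw [Fin.sum_univ_three]
      apply even_ext <;> intro j <;>
        simp only [add_entry, smul_entry, E_apply, F_apply, H_apply] <;>
        fin_cases j <;> simp
    rw [hx]
    exact Submodule.sum_mem _ fun i _ => add_mem (add_mem (Submodule.smul_mem _ _ (hE i))
      (Submodule.smul_mem _ _ (hF i))) (Submodule.smul_mem _ _ (hH i))
  · rw [eq_top_iff]
    intro v _
    have hv : v = v 0 0 0 • (g α).eo (E 0) (e 0) + (v 1 0 0 • e 0 + v 0 1 0 • e 1 + v 0 0 1 • e 2)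
        + ((2 * v 0 1 1) • f 0 + (2 * v 1 0 1) • f 1 + (2 * v 1 1 0) • f 2)
        + (2 * v 1 1 1) • (g α).eo (F 0) (f 0) := by
      change v = v 0 0 0 • act (E 0) (e 0) + (v 1 0 0 • e 0 + v 0 1 0 • e 1 + v 0 0 1 • e 2)
        + ((2 * v 0 1 1) • f 0 + (2 * v 1 0 1) • f 1 + (2 * v 1 1 0) • f 2)
        + (2 * v 1 1 1) • act (F 0) (f 0)
      apply odd_ext
      simp only [Fin.forall_fin_two]
      refine ⟨⟨⟨?_, ?_⟩, ?_, ?_⟩, ⟨?_, ?_⟩, ?_, ?_⟩ <;>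
        simp [act_apply, E_apply, F_apply, e, f, tens] <;> ring
    have k := fun (c : ℂ) {u : Odd} (hu : u ∈ p₁) => Submodule.smul_mem p₁ c hu
    rw [hv]
    exact add_mem (add_mem (add_mem (k _ (heo _ (hE 0) _ (he 0)))
      (add_mem (add_mem (k _ (he 0)) (k _ (he 1))) (k _ (he 2))))
      (add_mem (add_mem (k _ (hf 0)) (k _ (hf 1))) (k _ (hf 2))))
      (k _ (heo _ (hF 0) _ (hf 0)))

end D21

/-! ### The enveloping algebra: relations, universal property, stable subspaces. -/

namespace LieSuperalgebra

variable {g₀ g₁ : Type*} [AddCommGroup g₀] [Module ℂ g₀] [AddCommGroup g₁] [Module ℂ g₁]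

/-! The formulas for the `cᵢ` follow from `h_{i+1} + h_{i+2} = σᵢ Hᵢ` (`h_add_h`), where `σ =
(-(α+1), α, 1)`. For the second claim let `v` be the highest weight vector of `L(λ)`. Each `Eᵢ`
kills `v`, so no positive even root acts injectively, and the root space of `-αᵢ` is the line
through `Fᵢ`. Hence `inj L(λ) = Δ₀⁻` says that every `Fᵢ` acts injectively (`inj_eq_evenNeg_iff`).

The root `αᵢ` is not simple for the base of odd roots, so an odd reflection is made. Reflecting in
`βⱼ` gives the base `-βⱼ, α_{j+1}, α_{j+2}`, and with `j = i + 1` it contains `αᵢ`. The highest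
weight `μ` for the new base is `λ` if `λⱼ = 0` and `λ - βⱼ` otherwise (`exists_reflected`). By
`sl₂`-theory and simplicity, `Fᵢ` is injective iff `μ(Hᵢ)` is not a nonnegative integer
(`injective_iff_of_reflected`). As `βⱼ(Hᵢ) = 1`, for `λⱼ ≠ 0` this means `cᵢ ∉ ℤ_{≥1}`. For `λⱼ = 0`
the value `cᵢ = 0` is excluded as well, and then `cᵢ = 0` iff the remaining `λₖ` vanishes. So `Fᵢ`
is injective iff `cᵢ ∉ ℤ_{≥1}` and the two `λₖ` with `k ≠ i` are not both zero (`injective_iff`).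
Taking all `i` together gives the criterion.

It must also be shown that `v ≠ 0` (`vermaVec_not_mem_vermaMax`). This is done without the
Poincaré–Birkhoff–Witt theorem, in the manner of contragredient algebras. Operators satisfying the
Chevalley relations are put on the free module on words in the `fᵢ`, and the radical of the
resulting contravariant pairing is divided out. In the quotient the Serre relations hold
automatically (`chevalleySerre_quot`), so it is a `U(g)`-module with a nonzero highest weight
vector. A proper submodule of the Verma module cannot reach that vector, by a grading argument. -/

theorem evenι_mul_evenι (S : LieSuperalgebra g₀ g₁) (x y : g₀) :
    evenι S x * evenι S y - evenι S y * evenι S x = evenι S (S.ee x y) := by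
  have := RingQuot.mkAlgHom_rel ℂ (EnvRel.ee (S := S) x y)
  simpa [evenι, toEnv] using this

theorem evenι_mul_oddι (S : LieSuperalgebra g₀ g₁) (x : g₀) (v : g₁) :
    evenι S x * oddι S v - oddι S v * evenι S x = oddι S (S.eo x v) := by
  have := RingQuot.mkAlgHom_rel ℂ (EnvRel.eo (S := S) x v)
  simpa [evenι, oddι, toEnv] using this

theorem oddι_mul_oddι (S : LieSuperalgebra g₀ g₁) (v w : g₁) :
    oddι S v * oddι S w + oddι S w * oddι S v = evenι S (S.oo v w) := by
  have := RingQuot.mkAlgHom_rel ℂ (EnvRel.oo (S := S) v w)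
  simpa [evenι, oddι, toEnv] using this

/-- The universal property of the enveloping algebra. -/
theorem exists_env_hom (S : LieSuperalgebra g₀ g₁) {A : Type*} [Ring A] [Algebra ℂ A]
    (r₀ : g₀ →ₗ[ℂ] A) (r₁ : g₁ →ₗ[ℂ] A)
    (hee : ∀ x y, r₀ x * r₀ y - r₀ y * r₀ x = r₀ (S.ee x y))
    (heo : ∀ x v, r₀ x * r₁ v - r₁ v * r₀ x = r₁ (S.eo x v))
    (hoo : ∀ v w, r₁ v * r₁ w + r₁ w * r₁ v = r₀ (S.oo v w)) :
    ∃ Φ : Env S →ₐ[ℂ] A, (∀ x, Φ (evenι S x) = r₀ x) ∧ ∀ v, Φ (oddι S v) = r₁ v := by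
  refine ⟨RingQuot.liftAlgHom ℂ ⟨TensorAlgebra.lift ℂ (LinearMap.coprod r₀ r₁), ?_⟩, ?_, ?_⟩
  · intro a b hab
    cases hab with
    | ee x y => simp [hee]
    | eo x v => simp [heo]
    | oo v w => simp [hoo]
  · intro x
    simp [evenι, toEnv]
  · intro x
    simp [oddι, toEnv]

/-- A subspace that is stable under `g` is stable under `U(g)`. -/
theorem env_smul_mem (S : LieSuperalgebra g₀ g₁) {M : Type*} [AddCommGroup M] [Module ℂ M]
    [Module (Env S) M] [IsScalarTower ℂ (Env S) M] (P : Submodule ℂ M)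
    (h₀ : ∀ x, ∀ m ∈ P, evenι S x • m ∈ P) (h₁ : ∀ v, ∀ m ∈ P, oddι S v • m ∈ P)
    (u : Env S) : ∀ m ∈ P, u • m ∈ P := by
  obtain ⟨t, rfl⟩ := RingQuot.mkAlgHom_surjective ℂ (EnvRel S) u
  induction t using TensorAlgebra.induction with
  | algebraMap r =>
    intro m hm
    rw [AlgHom.commutes, algebraMap_smul]
    exact P.smul_mem _ hm
  | ι x =>
    intro m hm
    have : RingQuot.mkAlgHom ℂ (EnvRel S) (TensorAlgebra.ι ℂ x) = evenι S x.1 + oddι S x.2 := by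
      simp only [evenι, oddι, LinearMap.comp_apply, ← map_add]
      simp [toEnv]
    rw [this, add_smul]
    exact P.add_mem (h₀ _ _ hm) (h₁ _ _ hm)
  | mul a b ha hb =>
    intro m hm
    rw [map_mul, mul_smul]
    exact ha _ (hb _ hm)
  | add a b ha hb =>
    intro m hm
    rw [map_add, add_smul]
    exact P.add_mem (ha _ hm) (hb _ hm)

end LieSuperalgebra

namespace D21

open LieSuperalgebra

/-- A subspace that is stable under the Chevalley generators is stable under `U(g)`. -/
theorem env_smul_mem_of_generators {α : ℂ} (hα₀ : α ≠ 0) (hα₁ : α ≠ -1) {M : Type*}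
    [AddCommGroup M] [Module ℂ M] [Module (Env (g α)) M] [IsScalarTower ℂ (Env (g α)) M]
    (P : Submodule ℂ M) (he : ∀ i, ∀ m ∈ P, oddι (g α) (e i) • m ∈ P)
    (hf : ∀ i, ∀ m ∈ P, oddι (g α) (f i) • m ∈ P) (u : Env (g α)) : ∀ m ∈ P, u • m ∈ P := by
  have hsm : ∀ (c : ℂ) (u : Env (g α)) (m : M), (∀ m ∈ P, u • m ∈ P) → m ∈ P → (c • u) • m ∈ P :=
    fun c u m hu hm => by rw [smul_assoc]; exact P.smul_mem _ (hu _ hm)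
  -- The elements of `g` that preserve `P` form a subalgebra. It contains the Chevalley generators,
  -- so it is everything by `generate`.
  let p₀ : Submodule ℂ Even :=
    { carrier := {x | ∀ m ∈ P, evenι (g α) x • m ∈ P}
      zero_mem' := by intro m _; simp
      add_mem' := by
        intro x y hx hy m hm
        rw [map_add, add_smul]; exact P.add_mem (hx _ hm) (hy _ hm)
      smul_mem' := by
        intro c x hx m hm
        rw [map_smul]; exact hsm _ _ _ hx hm }
  let p₁ : Submodule ℂ Odd :=
    { carrier := {x | ∀ m ∈ P, oddι (g α) x • m ∈ P}
      zero_mem' := by intro m _; simp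
      add_mem' := by
        intro x y hx hy m hm
        rw [map_add, add_smul]; exact P.add_mem (hx _ hm) (hy _ hm)
      smul_mem' := by
        intro c x hx m hm
        rw [map_smul]; exact hsm _ _ _ hx hm }
  obtain ⟨t₀, t₁⟩ := generate α hα₀ hα₁ p₀ p₁
    (by
      intro x hx y hy m hm
      rw [← evenι_mul_evenι, sub_smul, mul_smul, mul_smul]
      exact P.sub_mem (hx _ (hy _ hm)) (hy _ (hx _ hm)))
    (by
      intro x hx y hy m hm
      rw [← evenι_mul_oddι, sub_smul, mul_smul, mul_smul]
      exact P.sub_mem (hx _ (hy _ hm)) (hy _ (hx _ hm)))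
    (by
      intro x hx y hy m hm
      rw [← oddι_mul_oddι, add_smul, mul_smul, mul_smul]
      exact P.add_mem (hx _ (hy _ hm)) (hy _ (hx _ hm)))
    he hf
  refine env_smul_mem (g α) P (fun x => ?_) (fun v => ?_) u
  · have : x ∈ p₀ := t₀ ▸ Submodule.mem_top
    exact this
  · have : v ∈ p₁ := t₁ ▸ Submodule.mem_top
    exact this

end D21

/-! ### Triangular relations and cyclic modules generated by singular vectors. -/

namespace D21

open LieSuperalgebra Polynomial

theorem aeval_smul_of_eigenvector {A M : Type*} [Ring A] [Algebra ℂ A] [AddCommGroup M]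
    [Module ℂ M] [Module A M] [IsScalarTower ℂ A M] {D : A} {c : ℂ} {m : M} (hm : D • m = c • m)
    (p : ℂ[X]) : aeval D p • m = p.eval c • m := by
  induction p using Polynomial.induction_on' with
  | add p q hp hq => rw [map_add, add_smul, hp, hq, eval_add, add_smul]
  | monomial n a =>
    rw [aeval_monomial, eval_monomial, mul_smul, algebraMap_smul, mul_smul]
    congr 1
    induction n with
    | zero => simp
    | succ n ih =>
      have : SMulCommClass A ℂ M := IsScalarTower.to_smulCommClass'
      rw [pow_succ, mul_smul, hm, smul_comm, ih, smul_smul, pow_succ, mul_comm]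

/-- Each spanning vector is killed by `X - c'` with `c' ≠ c`, and products of such factors handle
sums. The polynomial in the conclusion separates the eigenvalue `c` from the span, which replaces a
decomposition into weight spaces. -/
theorem exists_aeval_smul_eq_zero {A M : Type*} [Ring A] [Algebra ℂ A] [AddCommGroup M]
    [Module ℂ M] [Module A M] [IsScalarTower ℂ A M] {D : A} {c : ℂ} {V : Set M}
    (hV : ∀ m ∈ V, ∃ c', c' ≠ c ∧ D • m = c' • m) {m : M} (hm : m ∈ Submodule.span ℂ V) :
    ∃ p : ℂ[X], p.eval c ≠ 0 ∧ aeval D p • m = 0 := by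
  induction hm using Submodule.span_induction with
  | mem m hm =>
    obtain ⟨c', hc, h⟩ := hV m hm
    refine ⟨X - C c', ?_, ?_⟩
    · simpa [sub_eq_zero] using hc.symm
    · rw [aeval_smul_of_eigenvector h]
      simp
  | zero => exact ⟨1, by simp, by simp⟩
  | add m n _ _ hm hn =>
    obtain ⟨p, hp, hp'⟩ := hm
    obtain ⟨q, hq, hq'⟩ := hn
    refine ⟨p * q, by simp [hp, hq], ?_⟩
    rw [smul_add]
    nth_rewrite 1 [mul_comm p q]
    rw [map_mul, map_mul, mul_smul, mul_smul, hp', hq']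
    simp
  | smul r m _ hm =>
    obtain ⟨p, hp, hp'⟩ := hm
    have : SMulCommClass A ℂ M := IsScalarTower.to_smulCommClass'
    exact ⟨p, hp, by rw [smul_comm, hp', smul_zero]⟩

/-- The relations between the raising operators `x`, the lowering operators `y` of weights `-wt`
and the action `η` of `𝔥` that make every cyclic module generated by a vector killed by the `x`
the span of the words in the `y` applied to that vector. -/
structure Triangular {A : Type*} [Ring A] [Algebra ℂ A] (η : cartan →ₗ[ℂ] A) (x y : Fin 3 → A)
    (hh : Fin 3 → cartan) (wt : Fin 3 → Module.Dual ℂ cartan) (ε : Fin 3 → Fin 3 → ℂ) : Prop where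
  raise_lower : ∀ a b, x a * y b = ε a b • (y b * x a) + if a = b then η (hh a) else 0
  weight : ∀ t b, η t * y b = y b * η t - wt b t • y b

/-- The span of all words in the operators `y`, applied to `s`. -/
def wordSpan {A M : Type*} [Ring A] [AddCommGroup M] [Module ℂ M] [Module A M]
    (y : Fin 3 → A) (s : M) : Submodule ℂ M :=
  Submodule.span ℂ (Set.range fun w : List (Fin 3) => (w.map y).prod • s)

theorem self_mem_wordSpan {A M : Type*} [Ring A] [AddCommGroup M] [Module ℂ M] [Module A M]
    (y : Fin 3 → A) (s : M) : s ∈ wordSpan y s :=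
  Submodule.subset_span ⟨[], by simp⟩

section

variable {A M : Type*} [Ring A] [Algebra ℂ A] [AddCommGroup M] [Module ℂ M] [Module A M]
  [IsScalarTower ℂ A M] {η : cartan →ₗ[ℂ] A} {x y : Fin 3 → A} {hh : Fin 3 → cartan}
  {wt : Fin 3 → Module.Dual ℂ cartan} {ε : Fin 3 → Fin 3 → ℂ} {s : M} {μ : Module.Dual ℂ cartan}

theorem mem_of_forall_span {V : Set M} {P : Submodule ℂ M} (u : A)
    (h : ∀ m ∈ V, u • m ∈ P) {m : M} (hm : m ∈ Submodule.span ℂ V) : u • m ∈ P := by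
  have : SMulCommClass A ℂ M := IsScalarTower.to_smulCommClass'
  induction hm using Submodule.span_induction with
  | mem m hm => exact h m hm
  | zero => simp
  | add m n _ _ hm hn => rw [smul_add]; exact P.add_mem hm hn
  | smul r m _ hm => rw [smul_comm]; exact P.smul_mem _ hm

theorem lower_smul_mem_wordSpan (a : Fin 3) {m : M} (hm : m ∈ wordSpan y s) :
    y a • m ∈ wordSpan y s := by
  refine mem_of_forall_span _ ?_ hm
  rintro _ ⟨w, rfl⟩
  exact Submodule.subset_span ⟨a :: w, by simp [mul_smul]⟩

theorem Triangular.cartan_smul_word (T : Triangular η x y hh wt ε)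
    (hs : ∀ t, η t • s = μ t • s) (t : cartan) (w : List (Fin 3)) :
    η t • (w.map y).prod • s = (μ t - (w.map fun a => wt a t).sum) • (w.map y).prod • s := by
  have : SMulCommClass A ℂ M := IsScalarTower.to_smulCommClass'
  induction w with
  | nil => simp [hs]
  | cons a w ih =>
    rw [List.map_cons, List.prod_cons, mul_smul, ← mul_smul, T.weight, sub_smul, mul_smul, ih,
      smul_comm, smul_assoc, ← sub_smul, List.map_cons, List.sum_cons]
    congr 1
    ring

/-- A raising operator is moved to the right through the word. Every exchange leaves at most a
Cartan element applied to a shorter word, which is a scalar, and at the end the operator kills `s`.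
Together with the stability under the `y` this is the equality `U(g) s = U(n⁻) s`. -/
theorem Triangular.raise_smul_mem_wordSpan (T : Triangular η x y hh wt ε)
    (hs : ∀ t, η t • s = μ t • s) (hx : ∀ a, x a • s = 0) (a : Fin 3) {m : M}
    (hm : m ∈ wordSpan y s) : x a • m ∈ wordSpan y s := by
  refine mem_of_forall_span _ ?_ hm
  rintro _ ⟨w, rfl⟩
  dsimp only
  induction w with
  | nil => simp [hx]
  | cons b w ih =>
    rw [List.map_cons, List.prod_cons, mul_smul, ← mul_smul, T.raise_lower, add_smul, smul_assoc,
      mul_smul]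
    refine Submodule.add_mem _ (Submodule.smul_mem _ _ (lower_smul_mem_wordSpan _ ih)) ?_
    split_ifs
    · rw [T.cartan_smul_word hs]
      exact Submodule.smul_mem _ _ (Submodule.subset_span ⟨w, rfl⟩)
    · simp

/-- An eigenvector of a grading element `d` in the cyclic submodule of a vector killed by the
raising operators vanishes if its degree exceeds the degree of that vector. -/
theorem Triangular.eq_zero_of_degree (T : Triangular η x y hh wt ε)
    (hs : ∀ t, η t • s = μ t • s) {d : cartan} {k : Fin 3 → ℕ} (hk : ∀ a, wt a d = k a)
    {m : M} (hm : m ∈ wordSpan y s) {N : ℕ} (hN : 0 < N) (hd : η d • m = (μ d + N) • m) :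
    m = 0 := by
  obtain ⟨p, hp, hp'⟩ := exists_aeval_smul_eq_zero (D := η d) (c := μ d + N) (by
    rintro _ ⟨w, rfl⟩
    refine ⟨_, ?_, T.cartan_smul_word hs d w⟩
    -- A word has degree `μ d` minus a natural number, so its degree never equals `μ d + N` with `N
    -- > 0`.
    have : (w.map fun a => wt a d).sum = ((w.map k).sum : ℕ) := by
      simp [hk, Function.comp_def]
    rw [this]
    intro h
    have h' : ((N + (w.map k).sum : ℕ) : ℂ) = 0 := by
      push_cast
      push_cast at h
      linear_combination -h
    rw [Nat.cast_eq_zero] at h'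
    omega) hm
  rw [aeval_smul_of_eigenvector hd] at hp'
  exact (smul_eq_zero.1 hp').resolve_left hp

/-- An element of the cyclic module of a vector killed by the raising operators is the sum of a
multiple of that vector and an element killed by a polynomial in the grading element. -/
theorem Triangular.exists_decomposition (T : Triangular η x y hh wt ε)
    (hs : ∀ t, η t • s = μ t • s) {d : cartan} {k : Fin 3 → ℕ} (hk : ∀ a, wt a d = k a)
    (hk' : ∀ a, 0 < k a) {m : M} (hm : m ∈ wordSpan y s) :
    ∃ (c : ℂ) (n : M), m = c • s + n ∧
      n ∈ Submodule.span ℂ {m | ∃ (a : Fin 3) (m' : M), m = y a • m'} ∧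
      ∃ p : ℂ[X], p.eval (μ d) ≠ 0 ∧ aeval (η d) p • n = 0 := by
  -- `V` collects the nonempty words. Their degrees differ from `μ d` because every letter lowers
  -- the degree by some `k a > 0`.
  let V : Set M := Set.range fun w : Fin 3 × List (Fin 3) => ((w.1 :: w.2).map y).prod • s
  have hV : wordSpan y s ≤ Submodule.span ℂ {s} ⊔ Submodule.span ℂ V := by
    refine Submodule.span_le.2 ?_
    rintro _ ⟨w, rfl⟩
    cases w with
    | nil => exact Submodule.mem_sup_left (Submodule.subset_span (by simp))
    | cons a w => exact Submodule.mem_sup_right (Submodule.subset_span ⟨(a, w), rfl⟩)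
  obtain ⟨m₁, h₁, n, h₂, rfl⟩ := Submodule.mem_sup.1 (hV hm)
  obtain ⟨c, rfl⟩ := Submodule.mem_span_singleton.1 h₁
  refine ⟨c, n, rfl, ?_, exists_aeval_smul_eq_zero ?_ h₂⟩
  · refine Submodule.span_mono ?_ h₂
    rintro _ ⟨⟨a, w⟩, rfl⟩
    exact ⟨a, (w.map y).prod • s, by simp [mul_smul]⟩
  · rintro _ ⟨⟨a, w⟩, rfl⟩
    refine ⟨_, ?_, T.cartan_smul_word hs d (a :: w)⟩
    have : ((a :: w).map fun a => wt a d).sum = (((a :: w).map k).sum : ℕ) := by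
      simp [hk, Function.comp_def]
    rw [this]
    intro h
    have h' : ((((a :: w).map k).sum : ℕ) : ℂ) = 0 := by linear_combination -h
    rw [Nat.cast_eq_zero, List.map_cons, List.sum_cons] at h'
    have := hk' a
    omega

end

end D21

/-! ### Consequences of the Chevalley relations alone. -/

namespace D21

open LieSuperalgebra

/-- The relations of the Chevalley generators, without the Serre relations. -/
structure Chevalley (α : ℂ) {A : Type*} [Ring A] [Algebra ℂ A] (η : cartan →ₗ[ℂ] A)
    (x y : Fin 3 → A) : Prop where
  comm : ∀ s t, η s * η t = η t * η s
  weight_raise : ∀ t i, η t * x i = x i * η t + beta i t • x i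
  weight_lower : ∀ t i, η t * y i = y i * η t - beta i t • y i
  cross : ∀ i j, x i * y j + y j * x i = if i = j then η (h α i) else 0

/-- This is the identity `[a², b] = [a, {a, b}]`. -/
theorem sq_mul_of_anticommute {A : Type*} [Ring A] {a b c : A} (h : a * b + b * a = c) (hc : c * a = a * c) :
    a * a * b = b * (a * a) := by
  have h1 : a * (a * b + b * a) = a * c := by rw [h]
  have h2 : (a * b + b * a) * a = c * a := by rw [h]
  have : a * a * b - b * (a * a) = a * c - c * a := by rw [← h1, ← h2]; noncomm_ring
  rwa [hc, sub_self, sub_eq_zero] at this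

section

variable {α : ℂ} {A : Type*} [Ring A] [Algebra ℂ A] {η : cartan →ₗ[ℂ] A} {x y : Fin 3 → A}

/-- The Chevalley involution `e ↦ f`, `f ↦ -e`, `h ↦ -h`. It turns each statement about raising
operators into one about lowering operators. -/
theorem Chevalley.swap (C : Chevalley α η x y) : Chevalley α (-η) y (fun i => -x i) where
  comm s t := by simp [C.comm s t]
  weight_raise t i := by simp [C.weight_lower]; abel
  weight_lower t i := by simp [C.weight_raise]
  cross i j := by
    have := C.cross j i
    rw [LinearMap.neg_apply, mul_neg, neg_mul, ← neg_add, add_comm, this]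
    by_cases hij : i = j
    · subst hij; simp
    · rw [if_neg hij, if_neg (Ne.symm hij), neg_zero]

/-- The root vector of the even root `αᵢ`, up to a scalar. -/
noncomputable def evenVec (α : ℂ) (x : Fin 3 → A) (i : Fin 3) : A :=
  (sigma α i)⁻¹ • (x (i + 1) * x (i + 2) + x (i + 2) * x (i + 1))

/-- The root vector of the odd root `β₁ + β₂ + β₃`, up to a scalar. -/
noncomputable def topVec (α : ℂ) (x : Fin 3 → A) (i : Fin 3) : A :=
  evenVec α x i * x i - x i * evenVec α x i

theorem sigma_ne_zero (hα₀ : α ≠ 0) (hα₁ : α ≠ -1) (i : Fin 3) : sigma α i ≠ 0 := by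
  have hα₁' : α + 1 ≠ 0 := fun hh => hα₁ (by linear_combination hh)
  fin_cases i
  · exact neg_ne_zero.2 hα₁'
  · exact hα₀
  · exact one_ne_zero

theorem sigma_smul_evenVec (hα₀ : α ≠ 0) (hα₁ : α ≠ -1) (x : Fin 3 → A) (i : Fin 3) :
    sigma α i • evenVec α x i = x (i + 1) * x (i + 2) + x (i + 2) * x (i + 1) := by
  rw [evenVec, smul_inv_smul₀ (sigma_ne_zero hα₀ hα₁ i)]

/-- The off-diagonal entry at two indices is the `σ` of the third. With indices modulo 3 this makes
all computations cyclically symmetric. -/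
theorem cartanMatrix_values (α : ℂ) (i : Fin 3) : cartanMatrix α i i = 0 ∧
    cartanMatrix α i (i + 1) = sigma α (i + 2) ∧ cartanMatrix α i (i + 2) = sigma α (i + 1) ∧
    sigma α i + sigma α (i + 1) + sigma α (i + 2) = 0 := by
  fin_cases i <;> simp [cartanMatrix, sigma] <;> ring

theorem fin_three_add (i : Fin 3) : i + 1 + 1 = i + 2 ∧ i + 1 + 2 = i ∧ i + 2 + 1 = i ∧
    i + 2 + 2 = i + 1 ∧ i ≠ i + 1 ∧ i ≠ i + 2 ∧ i + 1 ≠ i ∧ i + 2 ≠ i ∧ i + 1 ≠ i + 2 ∧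
    i + 2 ≠ i + 1 := by
  revert i; decide

theorem fin_three_cases (i j : Fin 3) : j = i ∨ j = i + 1 ∨ j = i + 2 := by
  revert i j; decide

/-- The simple roots are isotropic: `βᵢ(hᵢ) = 0`, so `[eᵢ, fⱼ]` commutes with `eᵢ` for every `j`. -/
theorem Chevalley.sq_raise_mul (C : Chevalley α η x y) (i j : Fin 3) :
    x i * x i * y j = y j * (x i * x i) := by
  refine sq_mul_of_anticommute (C.cross i j) ?_
  split_ifs
  · rw [C.weight_raise, beta_h, (cartanMatrix_values α i).1, zero_smul, add_zero]
  · simp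

theorem Chevalley.evenVec_mul_aux (C : Chevalley α η x y) {i j : Fin 3} (hij : i ≠ j)
    (l : Fin 3) : (x i * x j + x j * x i) * y l - y l * (x i * x j + x j * x i) =
      (if i = l then -(beta j (h α i) • x j) else 0) +
      (if j = l then -(beta i (h α j) • x i) else 0) := by
  have h1 := C.cross i l
  have h2 := C.cross j l
  have h3 := C.weight_raise (h α i) j
  have h4 := C.weight_raise (h α j) i
  have key : (x i * x j + x j * x i) * y l - y l * (x i * x j + x j * x i) =
    x i * (x j * y l + y l * x j) + x j * (x i * y l + y l * x i)
      - (x i * y l + y l * x i) * x j - (x j * y l + y l * x j) * x i := by noncomm_ring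
  rw [key, h1, h2]
  by_cases hi : i = l
  · have hj : j ≠ l := fun h => hij (hi.trans h.symm)
    simp only [if_pos hi, if_neg hj, h3]
    simp
  · by_cases hj : j = l
    · simp only [if_neg hi, if_pos hj, h4]
      simp
    · simp [hi, hj]

/-- The Cartan entry between `i + 1` and `i + 2` is `σᵢ`. Dividing by it in `evenVec` makes the
structure constants here equal to `-1`. -/
theorem Chevalley.evenVec_mul (hα₀ : α ≠ 0) (hα₁ : α ≠ -1) (C : Chevalley α η x y) (i : Fin 3) :
    evenVec α x i * y i = y i * evenVec α x i ∧
    evenVec α x i * y (i + 1) = y (i + 1) * evenVec α x i - x (i + 2) ∧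
    evenVec α x i * y (i + 2) = y (i + 2) * evenVec α x i - x (i + 1) := by
  have hs := sigma_ne_zero hα₀ hα₁ i
  obtain ⟨a1, a2, a3, a4, n1, n2, n3, n4, n5, n6⟩ := fin_three_add i
  have key := fun l => C.evenVec_mul_aux n5 l
  have hb1 : beta (i + 1) (h α (i + 2)) = sigma α i := by
    have := (cartanMatrix_values α (i + 2)).2.2.1
    rwa [a4, a3, ← beta_h] at this
  have hb2 : beta (i + 2) (h α (i + 1)) = sigma α i := by
    have := (cartanMatrix_values α (i + 1)).2.1
    rwa [a1, a2, ← beta_h] at this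
  rw [hb1, hb2] at key
  refine ⟨?_, ?_, ?_⟩
  · have := key i
    simp only [if_neg n3, if_neg n4, add_zero] at this
    rw [← sub_eq_zero, evenVec, smul_mul_assoc, mul_smul_comm, ← smul_sub, this, smul_zero]
  · have := key (i + 1)
    simp only [if_true, if_neg n6, add_zero] at this
    rw [evenVec, smul_mul_assoc, mul_smul_comm]
    have h2 := congrArg (fun z => (sigma α i)⁻¹ • z) this
    simp only [smul_neg, inv_smul_smul₀ hs, smul_sub] at h2
    rw [sub_eq_iff_eq_add.1 h2]
    abel
  · have := key (i + 2)
    simp only [if_true, if_neg n5, zero_add] at this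
    rw [evenVec, smul_mul_assoc, mul_smul_comm]
    have h2 := congrArg (fun z => (sigma α i)⁻¹ • z) this
    simp only [smul_neg, inv_smul_smul₀ hs, smul_sub] at h2
    rw [sub_eq_iff_eq_add.1 h2]
    abel

theorem Chevalley.cartan_mul_evenVec (C : Chevalley α η x y) (t : cartan) (i : Fin 3) :
    η t * evenVec α x i =
      evenVec α x i * η t + (beta (i + 1) t + beta (i + 2) t) • evenVec α x i := by
  have h1 := C.weight_raise t (i + 1)
  have h2 := C.weight_raise t (i + 2)
  rw [evenVec, mul_smul_comm, smul_mul_assoc, smul_comm (_ + _), ← smul_add]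
  congr 1
  rw [mul_add, ← mul_assoc, ← mul_assoc, h1, h2, add_mul, add_mul, mul_assoc, mul_assoc, h1, h2]
  simp only [mul_add, add_mul, smul_mul_assoc, mul_smul_comm, ← mul_assoc]
  module

/-- The point is that the right-hand side does not depend on `i`. Hence the differences of the three
candidates for the root vector of `β₁ + β₂ + β₃` anticommute with all lowering operators, which will
force them to vanish. -/
theorem Chevalley.topVec_mul (hα₀ : α ≠ 0) (hα₁ : α ≠ -1) (C : Chevalley α η x y) (i j : Fin 3) :
    topVec α x i * y j + y j * topVec α x i = sigma α j • evenVec α x j := by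
  have key : topVec α x i * y j + y j * topVec α x i =
      evenVec α x i * (x i * y j + y j * x i) - (x i * y j + y j * x i) * evenVec α x i
      - ((evenVec α x i * y j - y j * evenVec α x i) * x i
        + x i * (evenVec α x i * y j - y j * evenVec α x i)) := by
    rw [topVec]; noncomm_ring
  obtain ⟨b1, b2, b3⟩ := C.evenVec_mul hα₀ hα₁ i
  obtain ⟨a1, a2, a3, a4, n1, n2, -⟩ := fin_three_add i
  rw [key, C.cross]
  rcases fin_three_cases i j with rfl | rfl | rfl
  · rw [if_pos rfl, b1, C.cartan_mul_evenVec, beta_h, beta_h]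
    obtain ⟨-, c2, c3, c4⟩ := cartanMatrix_values α j
    -- For equal indices the coefficient is `(β_{j+1} + β_{j+2})(hⱼ)`, and it becomes `-σⱼ` because
    -- the three `σ` add up to zero.
    rw [c2, c3, show sigma α (j + 2) + sigma α (j + 1) = - sigma α j by linear_combination c4]
    simp
  · rw [if_neg n1, b2, sigma_smul_evenVec hα₀ hα₁, a1, a2]
    noncomm_ring
  · rw [if_neg n2, b3, sigma_smul_evenVec hα₀ hα₁, a3, a4]
    noncomm_ring

end

end D21

/-! ### Serre relations, and the representation of `U(g)` that they define. -/

namespace D21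

open LieSuperalgebra

/-- The relations of the Chevalley generators, together with the Serre relations. -/
structure ChevalleySerre (α : ℂ) {A : Type*} [Ring A] [Algebra ℂ A] (η : cartan →ₗ[ℂ] A)
    (x y : Fin 3 → A) : Prop extends Chevalley α η x y where
  sq_raise : ∀ i, x i * x i = 0
  sq_lower : ∀ i, y i * y i = 0
  top_raise : ∀ i, topVec α x i = topVec α x 0
  top_lower : ∀ i, topVec α y i = topVec α y 0

section

variable {α : ℂ} {A : Type*} [Ring A] [Algebra ℂ A] {η : cartan →ₗ[ℂ] A} {x y : Fin 3 → A}

theorem evenVec_comm (hsq : ∀ i, x i * x i = 0) (htop : ∀ i, topVec α x i = topVec α x 0)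
    (j i : Fin 3) : evenVec α x j * x i - x i * evenVec α x j =
      if j = i then topVec α x 0 else 0 := by
  obtain ⟨a1, a2, a3, a4, n1, n2, -⟩ := fin_three_add j
  rcases fin_three_cases j i with rfl | rfl | rfl
  · rw [if_pos rfl, ← htop i, topVec]
  · rw [if_neg n1, evenVec, smul_mul_assoc, mul_smul_comm, ← smul_sub]
    have : (x (j + 1) * x (j + 2) + x (j + 2) * x (j + 1)) * x (j + 1)
      - x (j + 1) * (x (j + 1) * x (j + 2) + x (j + 2) * x (j + 1)) =
      x (j + 2) * (x (j + 1) * x (j + 1)) - (x (j + 1) * x (j + 1)) * x (j + 2) := by noncomm_ring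
    rw [this, hsq]; simp
  · rw [if_neg n2, evenVec, smul_mul_assoc, mul_smul_comm, ← smul_sub]
    have : (x (j + 1) * x (j + 2) + x (j + 2) * x (j + 1)) * x (j + 2)
      - x (j + 2) * (x (j + 1) * x (j + 2) + x (j + 2) * x (j + 1)) =
      x (j + 1) * (x (j + 2) * x (j + 2)) - (x (j + 2) * x (j + 2)) * x (j + 1) := by noncomm_ring
    rw [this, hsq]; simp

theorem neg_one_eq : (-1 : Fin 3) = 2 := rfl

theorem neg_two_eq : (-2 : Fin 3) = 1 := rfl

/-- As `0 + 1 + 2 = 0` modulo 3, the index different from two distinct indices `i`, `j` is `-(i +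
j)`. This expression is used for the third index from here on. -/
theorem third_index (j : Fin 3) : -(j + 1 + j) = j + 2 ∧ -(j + 2 + j) = j + 1 := by
  revert j; decide

theorem third_index_cases : ∀ i j : Fin 3, i ≠ j →
    (-(i + j) + 1 = i ∧ -(i + j) + 2 = j) ∨ (-(i + j) + 1 = j ∧ -(i + j) + 2 = i) := by
  decide

theorem anticommute_eq (hα₀ : α ≠ 0) (hα₁ : α ≠ -1) (hsq : ∀ i, x i * x i = 0) (i j : Fin 3) :
    x i * x j + x j * x i =
      if i = j then 0 else sigma α (-(i + j)) • evenVec α x (-(i + j)) := by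
  by_cases hij : i = j
  · subst hij; simp [hsq]
  · rw [if_neg hij, sigma_smul_evenVec hα₀ hα₁]
    rcases third_index_cases i j hij with ⟨h1, h2⟩ | ⟨h1, h2⟩ <;> rw [h1, h2]
    rw [add_comm]

theorem topVec_anticommute (hsq : ∀ i, x i * x i = 0) (htop : ∀ i, topVec α x i = topVec α x 0)
    (i : Fin 3) : x i * topVec α x 0 + topVec α x 0 * x i = 0 := by
  rw [← htop i]
  have : x i * topVec α x i + topVec α x i * x i =
    evenVec α x i * (x i * x i) - (x i * x i) * evenVec α x i := by rw [topVec]; noncomm_ring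
  rw [this, hsq]; simp

theorem Chevalley.evenVec_lower_comm (hα₀ : α ≠ 0) (hα₁ : α ≠ -1) (C : Chevalley α η x y)
    (j i : Fin 3) : evenVec α x j * y i - y i * evenVec α x j =
      if j = i then 0 else -x (-(i + j)) := by
  obtain ⟨b1, b2, b3⟩ := C.evenVec_mul hα₀ hα₁ j
  obtain ⟨-, -, -, -, n1, n2, -⟩ := fin_three_add j
  rcases fin_three_cases j i with rfl | rfl | rfl
  · rw [if_pos rfl, b1, sub_self]
  · rw [if_neg n1, b2, (third_index j).1]
    abel
  · rw [if_neg n2, b3, (third_index j).2]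
    abel

theorem Chevalley.evenVec_raise_comm (hα₀ : α ≠ 0) (hα₁ : α ≠ -1) (C : Chevalley α η x y)
    (j i : Fin 3) : evenVec α y j * x i - x i * evenVec α y j =
      if j = i then 0 else y (-(i + j)) := by
  have := C.swap.evenVec_lower_comm hα₀ hα₁ j i
  rw [← neg_inj]
  simp only [mul_neg, neg_mul] at this
  rw [neg_sub, ← neg_add_eq_sub, add_comm]
  convert this using 1
  · abel
  · split_ifs <;> simp

theorem Chevalley.topVec_raise (hα₀ : α ≠ 0) (hα₁ : α ≠ -1) (C : Chevalley α η x y) (i j : Fin 3) :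
    x j * topVec α y i + topVec α y i * x j = -(sigma α j • evenVec α y j) := by
  rw [← C.swap.topVec_mul hα₀ hα₁ i j]
  simp only [mul_neg, neg_mul]
  abel

theorem Chevalley.raise_mul_lower (C : Chevalley α η x y) (i j : Fin 3) :
    x i * y j = (-1 : ℂ) • (y j * x i) + if i = j then η (h α i) else 0 := by
  rw [← C.cross]
  module

theorem Chevalley.sq_lower_mul (C : Chevalley α η x y) (i j : Fin 3) :
    y i * y i * x j = x j * (y i * y i) := by
  have := C.swap.sq_raise_mul i j
  rwa [mul_neg, neg_mul, neg_inj] at this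

theorem Chevalley.topVec_sub_mul_lower (hα₀ : α ≠ 0) (hα₁ : α ≠ -1) (C : Chevalley α η x y)
    (i k j : Fin 3) : (topVec α x i - topVec α x k) * y j =
      (-1 : ℂ) • (y j * (topVec α x i - topVec α x k)) := by
  have h1 := C.topVec_mul hα₀ hα₁ i j
  rw [← C.topVec_mul hα₀ hα₁ k j, ← sub_eq_zero] at h1
  rw [neg_smul, one_smul, ← sub_eq_zero, ← h1]
  noncomm_ring

theorem Chevalley.topVec_sub_mul_raise (hα₀ : α ≠ 0) (hα₁ : α ≠ -1) (C : Chevalley α η x y)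
    (i k j : Fin 3) : (topVec α y i - topVec α y k) * x j =
      (-1 : ℂ) • (x j * (topVec α y i - topVec α y k)) := by
  have h1 := C.topVec_raise hα₀ hα₁ i j
  rw [← C.topVec_raise hα₀ hα₁ k j, ← sub_eq_zero] at h1
  rw [neg_smul, one_smul, ← sub_eq_zero, ← h1]
  noncomm_ring

/-- The even part of the representation given by Chevalley generators. -/
noncomputable def evenRep (α : ℂ) (η : cartan →ₗ[ℂ] A) (x y : Fin 3 → A) : Even →ₗ[ℂ] A where
  -- The constants invert `[e_{j+1}, e_{j+2}] = -2 σⱼ Eⱼ` and `[f_{j+1}, f_{j+2}] = (σⱼ / 2) Fⱼ`,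
  -- with `σⱼ` already divided out in `evenVec`.
  toFun t := ∑ j, ((t j).1 0 1 • ((-1 / 2 : ℂ) • evenVec α x j)
    + (t j).1 1 0 • ((2 : ℂ) • evenVec α y j) + (t j).1 0 0 • η (H α j))
  map_add' s t := by
    rw [← Finset.sum_add_distrib]
    refine Finset.sum_congr rfl fun j _ => ?_
    simp only [add_entry]
    module
  map_smul' c t := by
    rw [Finset.smul_sum]
    refine Finset.sum_congr rfl fun j _ => ?_
    simp only [smul_entry, RingHom.id_apply]
    module

theorem evenRep_apply (t : Even) : evenRep α η x y t =
    ∑ j, ((t j).1 0 1 • ((-1 / 2 : ℂ) • evenVec α x j)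
    + (t j).1 1 0 • ((2 : ℂ) • evenVec α y j) + (t j).1 0 0 • η (H α j)) := rfl

/-- The odd part of the representation given by Chevalley generators. -/
noncomputable def oddRep (α : ℂ) (x y : Fin 3 → A) : Odd →ₗ[ℂ] A where
  -- The extreme tensors are `[E₀, e₀]` and `2 [F₀, f₀]`, and the images of `E₀` and `F₀` are `-1/2`
  -- and `2` times the respective `evenVec`. This gives the factors `-1/2` and `4`; the factors `2`
  -- undo the `1/2` in the definition of `f`.
  toFun v := v 0 0 0 • ((-1 / 2 : ℂ) • topVec α x 0)
    + (v 1 0 0 • x 0 + v 0 1 0 • x 1 + v 0 0 1 • x 2)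
    + (v 0 1 1 • ((2 : ℂ) • y 0) + v 1 0 1 • ((2 : ℂ) • y 1) + v 1 1 0 • ((2 : ℂ) • y 2))
    + v 1 1 1 • ((4 : ℂ) • topVec α y 0)
  map_add' v w := by
    simp only [Pi.add_apply]
    module
  map_smul' c v := by
    simp only [Pi.smul_apply, RingHom.id_apply, smul_eq_mul]
    module

theorem forall_fin_three {p : Fin 3 → Prop} (h0 : p 0) (h1 : p 1) (h2 : p 2) (i : Fin 3) :
    p i := by
  fin_cases i
  exacts [h0, h1, h2]

theorem oddRep_e (i : Fin 3) : oddRep α x y (e i) = x i := by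
  revert i
  refine forall_fin_three ?_ ?_ ?_ <;> simp [oddRep, e, tens]

theorem oddRep_f (i : Fin 3) : oddRep α x y (f i) = y i := by
  revert i
  refine forall_fin_three ?_ ?_ ?_ <;> simp [oddRep, f, tens, smul_smul]

theorem evenRep_cartan (t : cartan) : evenRep α η x y t = η t := by
  have ht : t = ∑ j, (t.1 j).1 0 0 • H α j := by
    apply Subtype.ext
    have k0 := fun j => (t.2 j).1
    have k1 := fun j => (t.2 j).2
    rw [Fin.sum_univ_three]
    apply even_ext <;> intro j <;>
      simp only [Submodule.coe_add, Submodule.coe_smul, add_entry, smul_entry, H_apply, k0, k1] <;>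
      revert j <;> refine forall_fin_three ?_ ?_ ?_ <;> simp
  conv_rhs => rw [ht]
  rw [map_sum, evenRep_apply]
  refine Finset.sum_congr rfl fun j _ => ?_
  simp [t.2 j]

theorem h_eq (α : ℂ) :
    h α 0 = (1 / 2 : ℂ) • ((-sigma α 0) • H α 0 + sigma α 1 • H α 1 + sigma α 2 • H α 2) ∧
    h α 1 = (1 / 2 : ℂ) • (sigma α 0 • H α 0 + (-sigma α 1) • H α 1 + sigma α 2 • H α 2) ∧
    h α 2 = (1 / 2 : ℂ) • (sigma α 0 • H α 0 + sigma α 1 • H α 1 + (-sigma α 2) • H α 2) := by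
  refine ⟨?_, ?_, ?_⟩ <;> apply Subtype.ext <;> apply even_ext <;> intro j
  all_goals
    simp only [Submodule.coe_add, Submodule.coe_smul, add_entry, smul_entry, H_apply, h_entry,
      ((h α _).2 _).1, ((h α _).2 _).2]
  all_goals
    revert j
    refine forall_fin_three ?_ ?_ ?_ <;> simp [sigma] <;> try ring

theorem beta_H (α : ℂ) (i j : Fin 3) : beta i (H α j) = if i = j then -1 else 1 := by
  revert i j
  refine forall_fin_three ?_ ?_ ?_ <;> refine forall_fin_three ?_ ?_ ?_ <;>
    simp [beta, eps_apply, H_apply]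

theorem evenRep_comm (a : A) (t : Even) : evenRep α η x y t * a - a * evenRep α η x y t =
    ∑ j, ((t j).1 0 1 • ((-1 / 2 : ℂ) • (evenVec α x j * a - a * evenVec α x j))
    + (t j).1 1 0 • ((2 : ℂ) • (evenVec α y j * a - a * evenVec α y j))
    + (t j).1 0 0 • (η (H α j) * a - a * η (H α j))) := by
  rw [evenRep_apply, Finset.sum_mul, Finset.mul_sum, ← Finset.sum_sub_distrib]
  refine Finset.sum_congr rfl fun j _ => ?_
  simp only [add_mul, mul_add, smul_mul_assoc, mul_smul_comm]
  module

theorem oddRep_anticomm (a : A) (v : Odd) : a * oddRep α x y v + oddRep α x y v * a =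
    v 0 0 0 • ((-1 / 2 : ℂ) • (a * topVec α x 0 + topVec α x 0 * a))
    + (v 1 0 0 • (a * x 0 + x 0 * a) + v 0 1 0 • (a * x 1 + x 1 * a)
      + v 0 0 1 • (a * x 2 + x 2 * a))
    + (v 0 1 1 • ((2 : ℂ) • (a * y 0 + y 0 * a)) + v 1 0 1 • ((2 : ℂ) • (a * y 1 + y 1 * a))
      + v 1 1 0 • ((2 : ℂ) • (a * y 2 + y 2 * a)))
    + v 1 1 1 • ((4 : ℂ) • (a * topVec α y 0 + topVec α y 0 * a)) := by
  change a * (_ + _ + _ + _) + (_ + _ + _ + _) * a = _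
  simp only [add_mul, mul_add, smul_mul_assoc, mul_smul_comm]
  module

/-- This and the three following lemmas check the bracket relations only when one argument is a
Chevalley generator. The Jacobi identity gives the rest. -/
theorem ChevalleySerre.evenRep_raise (hα₀ : α ≠ 0) (hα₁ : α ≠ -1) (C : ChevalleySerre α η x y)
    (i : Fin 3) (t : Even) :
    evenRep α η x y t * x i - x i * evenRep α η x y t = oddRep α x y (act t (e i)) := by
  have hη : ∀ s, η s * x i - x i * η s = beta i s • x i := fun s => by
    rw [C.weight_raise, add_sub_cancel_left]
  rw [evenRep_comm]
  simp only [evenVec_comm C.sq_raise C.top_raise, C.evenVec_raise_comm hα₀ hα₁, hη, beta_H,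
    Fin.sum_univ_three, oddRep, LinearMap.coe_mk, AddHom.coe_mk]
  revert i
  refine forall_fin_three ?_ ?_ ?_ <;> intro _ <;>
    simp [act_apply, e, tens, trace_zero, neg_one_eq, neg_two_eq] <;> module

theorem ChevalleySerre.evenRep_lower (hα₀ : α ≠ 0) (hα₁ : α ≠ -1) (C : ChevalleySerre α η x y)
    (i : Fin 3) (t : Even) :
    evenRep α η x y t * y i - y i * evenRep α η x y t = oddRep α x y (act t (f i)) := by
  have hη : ∀ s, η s * y i - y i * η s = -beta i s • y i := fun s => by
    rw [C.weight_lower, sub_sub_cancel_left, neg_smul]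
  rw [evenRep_comm]
  simp only [evenVec_comm C.sq_lower C.top_lower, C.evenVec_lower_comm hα₀ hα₁, hη, beta_H,
    Fin.sum_univ_three, oddRep, LinearMap.coe_mk, AddHom.coe_mk]
  revert i
  refine forall_fin_three ?_ ?_ ?_ <;> intro _ <;>
    simp [act_apply, f, tens, trace_zero, neg_one_eq, neg_two_eq] <;> module

theorem ChevalleySerre.oddRep_raise (hα₀ : α ≠ 0) (hα₁ : α ≠ -1) (C : ChevalleySerre α η x y)
    (i : Fin 3) (w : Odd) : x i * oddRep α x y w + oddRep α x y w * x i =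
      evenRep α η x y (oddBracket α (e i) w) := by
  obtain ⟨h0, h1, h2⟩ := h_eq α
  rw [oddRep_anticomm]
  simp only [topVec_anticommute C.sq_raise C.top_raise, anticommute_eq hα₀ hα₁ C.sq_raise,
    C.cross, C.topVec_raise hα₀ hα₁]
  simp only [Fin.sum_univ_three, evenRep, LinearMap.coe_mk, AddHom.coe_mk,
    oddBracket_00, oddBracket_01, oddBracket_10, contr_zero, contr_one, contr_two]
  revert i
  refine forall_fin_three ?_ ?_ ?_ <;>
    simp [e, tens, h0, h1, h2, neg_one_eq, neg_two_eq] <;> module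

theorem ChevalleySerre.oddRep_lower (hα₀ : α ≠ 0) (hα₁ : α ≠ -1) (C : ChevalleySerre α η x y)
    (i : Fin 3) (w : Odd) : y i * oddRep α x y w + oddRep α x y w * y i =
      evenRep α η x y (oddBracket α (f i) w) := by
  obtain ⟨h0, h1, h2⟩ := h_eq α
  have hc : ∀ j, y i * x j + x j * y i = if j = i then η (h α j) else 0 := fun j => by
    rw [add_comm, C.cross]
  have ht : y i * topVec α x 0 + topVec α x 0 * y i = sigma α i • evenVec α x i := by
    rw [add_comm, C.topVec_mul hα₀ hα₁]
  rw [oddRep_anticomm]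
  simp only [topVec_anticommute C.sq_lower C.top_lower, anticommute_eq hα₀ hα₁ C.sq_lower, hc, ht]
  simp only [Fin.sum_univ_three, evenRep, LinearMap.coe_mk, AddHom.coe_mk,
    oddBracket_00, oddBracket_01, oddBracket_10, contr_zero, contr_one, contr_two]
  clear hc ht
  revert i
  refine forall_fin_three ?_ ?_ ?_ <;>
    simp [f, tens, h0, h1, h2, neg_one_eq, neg_two_eq] <;> module

/-- Operators that satisfy the relations of the Chevalley generators and the Serre relations
define a representation of `U(g)`. -/
theorem ChevalleySerre.exists_env_hom (hα₀ : α ≠ 0) (hα₁ : α ≠ -1)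
    (C : ChevalleySerre α η x y) : ∃ Φ : Env (g α) →ₐ[ℂ] A,
      (∀ t : cartan, Φ (evenι (g α) t) = η t) ∧ (∀ i, Φ (oddι (g α) (e i)) = x i) ∧
      ∀ i, Φ (oddι (g α) (f i)) = y i := by
  let r₀ := evenRep α η x y
  let r₁ := oddRep α x y
  -- `p₀` and `p₁` consist of the elements whose brackets with all of `g` are respected by `r₀` and
  -- `r₁`. The Jacobi identity makes them a subalgebra, and it contains the generators, so
  -- `generate` applies.
  let p₀ : Submodule ℂ Even :=
    { carrier := {t | (∀ s, r₀ t * r₀ s - r₀ s * r₀ t = r₀ ((g α).ee t s)) ∧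
        ∀ w, r₀ t * r₁ w - r₁ w * r₀ t = r₁ ((g α).eo t w)}
      zero_mem' := by simp
      add_mem' := by
        rintro a b ⟨ha, ha'⟩ ⟨hb, hb'⟩
        refine ⟨fun s => ?_, fun w => ?_⟩
        · rw [map_add (g α).ee, LinearMap.add_apply, map_add, map_add, ← ha, ← hb]; noncomm_ring
        · rw [map_add (g α).eo, LinearMap.add_apply, map_add, map_add, ← ha', ← hb']; noncomm_ring
      smul_mem' := by
        rintro c a ⟨ha, ha'⟩
        refine ⟨fun s => ?_, fun w => ?_⟩
        · rw [map_smul (g α).ee, LinearMap.smul_apply, map_smul, map_smul, ← ha, smul_sub,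
            smul_mul_assoc, mul_smul_comm]
        · rw [map_smul (g α).eo, LinearMap.smul_apply, map_smul, map_smul, ← ha', smul_sub,
            smul_mul_assoc, mul_smul_comm] }
  let p₁ : Submodule ℂ Odd :=
    { carrier := {v | (∀ s, r₀ s * r₁ v - r₁ v * r₀ s = r₁ ((g α).eo s v)) ∧
        ∀ w, r₁ v * r₁ w + r₁ w * r₁ v = r₀ ((g α).oo v w)}
      zero_mem' := by simp
      add_mem' := by
        rintro a b ⟨ha, ha'⟩ ⟨hb, hb'⟩
        refine ⟨fun s => ?_, fun w => ?_⟩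
        · rw [map_add ((g α).eo s), map_add, map_add, ← ha, ← hb]; noncomm_ring
        · rw [map_add (g α).oo, LinearMap.add_apply, map_add, map_add, ← ha', ← hb']; noncomm_ring
      smul_mem' := by
        rintro c a ⟨ha, ha'⟩
        refine ⟨fun s => ?_, fun w => ?_⟩
        · rw [map_smul ((g α).eo s), map_smul, map_smul, ← ha, smul_sub,
            smul_mul_assoc, mul_smul_comm]
        · rw [map_smul (g α).oo, LinearMap.smul_apply, map_smul, map_smul, ← ha', smul_add,
            smul_mul_assoc, mul_smul_comm] }
  obtain ⟨t₀, t₁⟩ := generate α hα₀ hα₁ p₀ p₁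
    (by
      rintro a ⟨ha, ha'⟩ b ⟨hb, hb'⟩
      refine ⟨fun s => ?_, fun w => ?_⟩
      · have := (g α).jacobi_eee a b s
        rw [← sub_eq_iff_eq_add] at this
        rw [← this, map_sub, ← ha, ← ha, ← hb, ← hb, ← ha]
        noncomm_ring
      · have := (g α).jacobi_eeo a b w
        rw [← sub_eq_iff_eq_add] at this
        rw [← this, map_sub, ← ha, ← ha', ← hb', ← hb', ← ha']
        noncomm_ring)
    (by
      rintro a ⟨ha, ha'⟩ v ⟨hv, hv'⟩
      refine ⟨fun s => ?_, fun w => ?_⟩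
      · have := (g α).jacobi_eeo a s v
        rw [← sub_eq_iff_eq_add'] at this
        have h2 : (g α).eo s ((g α).eo a v) =
          (g α).eo a ((g α).eo s v) - (g α).eo ((g α).ee a s) v := by rw [← this]
        rw [h2, map_sub, ← ha', ← ha', ← hv, ← hv, ← ha]
        noncomm_ring
      · have := (g α).jacobi_eoo a v w
        rw [← sub_eq_iff_eq_add] at this
        rw [← this, map_sub, ← ha, ← ha', ← hv', ← hv', ← ha']
        noncomm_ring)
    (by
      rintro v ⟨hv, hv'⟩ w ⟨hw, hw'⟩
      refine ⟨fun s => ?_, fun u => ?_⟩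
      · have h1 := (g α).jacobi_eoo s v w
        have h2 : (g α).ee ((g α).oo v w) s = -(g α).ee s ((g α).oo v w) := by
          have h3 := (g α).ee_self (s + (g α).oo v w)
          simp only [map_add, LinearMap.add_apply, (g α).ee_self, zero_add, add_zero] at h3
          exact eq_neg_of_add_eq_zero_left h3
        rw [h2, h1, map_neg, map_add, (g α).oo_symm ((g α).eo s v) w, ← hw', ← hv', ← hv', ← hv,
          ← hw]
        noncomm_ring
      · have h1 := (g α).jacobi_ooo v w u
        have h2 : (g α).eo ((g α).oo v w) u =
            -((g α).eo ((g α).oo w u) v + (g α).eo ((g α).oo v u) w) := by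
          rw [(g α).oo_symm v u, eq_neg_iff_add_eq_zero, ← h1]
          abel
        rw [h2, map_neg, map_add, ← hv, ← hw, ← hv', ← hw', ← hv']
        noncomm_ring)
    (fun i => ⟨fun s => by
      change r₀ s * oddRep α x y (e i) - oddRep α x y (e i) * r₀ s = _
      rw [oddRep_e]; exact C.evenRep_raise hα₀ hα₁ i s, fun w => by
      change oddRep α x y (e i) * r₁ w + r₁ w * oddRep α x y (e i) = _
      rw [oddRep_e]; exact C.oddRep_raise hα₀ hα₁ i w⟩)
    (fun i => ⟨fun s => by
      change r₀ s * oddRep α x y (f i) - oddRep α x y (f i) * r₀ s = _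
      rw [oddRep_f]; exact C.evenRep_lower hα₀ hα₁ i s, fun w => by
      change oddRep α x y (f i) * r₁ w + r₁ w * oddRep α x y (f i) = _
      rw [oddRep_f]; exact C.oddRep_lower hα₀ hα₁ i w⟩)
  have m₀ : ∀ t, t ∈ p₀ := fun t => t₀ ▸ Submodule.mem_top
  have m₁ : ∀ t, t ∈ p₁ := fun t => t₁ ▸ Submodule.mem_top
  obtain ⟨Φ, h₀, h₁⟩ := LieSuperalgebra.exists_env_hom (g α) r₀ r₁ (fun t s => (m₀ t).1 s)
    (fun t v => (m₀ t).2 v) (fun v w => (m₁ v).2 w)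
  exact ⟨Φ, fun t => (h₀ t).trans (evenRep_cartan t), fun i => (h₁ _).trans (oddRep_e i),
    fun i => (h₁ _).trans (oddRep_f i)⟩

end

end D21

/-! ### A highest weight module built from words, modulo the radical. -/

namespace D21

open LieSuperalgebra

/-- The free module on the words in the lowering operators. -/
abbrev FreeVerma : Type := List (Fin 3) →₀ ℂ

namespace FreeVerma

/-- The weight of a word. -/
noncomputable def wordWeight (lam : Module.Dual ℂ cartan) (w : List (Fin 3)) :
    Module.Dual ℂ cartan :=
  lam - (w.map beta).sum

/-- The lowering operators. -/
noncomputable def lower (i : Fin 3) : Module.End ℂ FreeVerma :=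
  Finsupp.lmapDomain ℂ ℂ (List.cons i)

/-- The action of the Cartan subalgebra. -/
noncomputable def cart (lam : Module.Dual ℂ cartan) : cartan →ₗ[ℂ] Module.End ℂ FreeVerma where
  toFun t := Finsupp.linearCombination ℂ fun w => wordWeight lam w t • Finsupp.single w 1
  map_add' s t := by
    ext w : 2
    simp [add_smul]
  map_smul' c t := by
    ext w : 2
    simp [mul_smul]

/-- The raising operators, on words. -/
noncomputable def raiseWord (α : ℂ) (lam : Module.Dual ℂ cartan) (i : Fin 3) :
    List (Fin 3) → FreeVerma
  | [] => 0
  | j :: w => (if i = j then wordWeight lam w (h α i) • Finsupp.single w 1 else 0)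
      - lower j (raiseWord α lam i w)

/-- The raising operators. -/
noncomputable def raise (α : ℂ) (lam : Module.Dual ℂ cartan) (i : Fin 3) :
    Module.End ℂ FreeVerma :=
  Finsupp.linearCombination ℂ (raiseWord α lam i)

variable (α : ℂ) (lam : Module.Dual ℂ cartan)

theorem lower_single (i : Fin 3) (w : List (Fin 3)) :
    lower i (Finsupp.single w 1) = Finsupp.single (i :: w) 1 := by
  simp [lower]

theorem cart_single (t : cartan) (w : List (Fin 3)) :
    cart lam t (Finsupp.single w 1) = wordWeight lam w t • Finsupp.single w 1 := by
  simp [cart]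

theorem raise_single (i : Fin 3) (w : List (Fin 3)) :
    raise α lam i (Finsupp.single w 1) = raiseWord α lam i w := by
  simp [raise]

theorem wordWeight_cons (i : Fin 3) (w : List (Fin 3)) (t : cartan) :
    wordWeight lam (i :: w) t = wordWeight lam w t - beta i t := by
  simp [wordWeight]
  ring

theorem cart_lower (t : cartan) (i : Fin 3) :
    cart lam t * lower i = lower i * cart lam t - beta i t • lower i := by
  ext w : 2
  simp only [LinearMap.comp_apply, Finsupp.lsingle_apply, Module.End.mul_apply,
    LinearMap.sub_apply, LinearMap.smul_apply, lower_single, cart_single, map_smul,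
    wordWeight_cons, sub_smul]

theorem cart_raiseWord (t : cartan) (i : Fin 3) (w : List (Fin 3)) :
    cart lam t (raiseWord α lam i w) = (wordWeight lam w t + beta i t) • raiseWord α lam i w := by
  induction w with
  | nil => simp [raiseWord]
  | cons j w ih =>
    have h1 := LinearMap.congr_fun (cart_lower lam t j) (raiseWord α lam i w)
    simp only [Module.End.mul_apply, LinearMap.sub_apply, LinearMap.smul_apply, ih,
      map_smul] at h1
    rw [raiseWord, map_sub, h1, wordWeight_cons]
    by_cases hij : i = j
    · subst hij
      rw [if_pos rfl, map_smul, cart_single]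
      module
    · rw [if_neg hij, map_zero]
      module

/-- The relation between raising and lowering operators is the recursion that defines `raiseWord`,
read backwards. No Serre relation is available on the free module. -/
theorem chevalley : Chevalley α (cart lam) (raise α lam) lower where
  comm s t := by
    ext w : 2
    simp only [LinearMap.comp_apply, Finsupp.lsingle_apply, Module.End.mul_apply, cart_single,
      map_smul]
    rw [smul_comm]
  weight_raise t i := by
    ext w : 2
    simp only [LinearMap.comp_apply, Finsupp.lsingle_apply, Module.End.mul_apply, cart_single,
      map_smul, LinearMap.add_apply, LinearMap.smul_apply, raise_single, cart_raiseWord, add_smul]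
  weight_lower t i := cart_lower lam t i
  cross i j := by
    ext w : 2
    simp only [LinearMap.comp_apply, Finsupp.lsingle_apply, Module.End.mul_apply,
      LinearMap.add_apply, lower_single, raise_single]
    rw [raiseWord, sub_add_cancel]
    split_ifs
    · rw [cart_single]
    · rfl

/-- The coefficient of the empty word. -/
noncomputable def coeff : FreeVerma →ₗ[ℂ] ℂ := Finsupp.lapply []

theorem coeff_lower (i : Fin 3) (m : FreeVerma) : coeff (lower i m) = 0 := by
  have : coeff ∘ₗ lower i = 0 := by
    ext w
    simp [coeff, lower]
  exact LinearMap.congr_fun this m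

theorem coeff_cart (t : cartan) (m : FreeVerma) : coeff (cart lam t m) = lam t * coeff m := by
  have : coeff ∘ₗ cart lam t = lam t • coeff := by
    ext w
    simp only [LinearMap.comp_apply, Finsupp.lsingle_apply, cart_single, map_smul,
      LinearMap.smul_apply]
    by_cases hw : w = []
    · subst hw
      simp [wordWeight]
    · simp [coeff, hw]
  exact LinearMap.congr_fun this m

/-- The radical: the elements that no word in the raising operators maps to an element with
nonzero coefficient of the empty word. -/
noncomputable def radical : Submodule ℂ FreeVerma :=
  ⨅ w : List (Fin 3), LinearMap.ker (coeff ∘ₗ (w.map (raise α lam)).prod)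

theorem mem_radical {m : FreeVerma} :
    m ∈ radical α lam ↔ ∀ w : List (Fin 3), coeff ((w.map (raise α lam)).prod m) = 0 := by
  simp [radical]

theorem raise_mem_radical (i : Fin 3) :
    radical α lam ≤ (radical α lam).comap (raise α lam i) := by
  intro m hm
  rw [Submodule.mem_comap, mem_radical]
  intro w
  have := (mem_radical α lam).1 hm (w ++ [i])
  simpa using this

theorem exists_raise_cart (t : cartan) (w : List (Fin 3)) : ∃ c : ℂ,
    (w.map (raise α lam)).prod * cart lam t =
      cart lam t * (w.map (raise α lam)).prod + c • (w.map (raise α lam)).prod := by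
  induction w with
  | nil => exact ⟨0, by simp⟩
  | cons i w ih =>
    obtain ⟨c, hc⟩ := ih
    refine ⟨c - beta i t, ?_⟩
    rw [List.map_cons, List.prod_cons, mul_assoc, hc, mul_add, ← mul_assoc, ← mul_assoc,
      (chevalley α lam).weight_raise t i, add_mul, mul_smul_comm, smul_mul_assoc]
    module

theorem cart_mem_radical (t : cartan) :
    radical α lam ≤ (radical α lam).comap (cart lam t) := by
  intro m hm
  rw [Submodule.mem_comap, mem_radical]
  intro w
  obtain ⟨c, hc⟩ := exists_raise_cart α lam t w
  have h1 := LinearMap.congr_fun hc m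
  rw [Module.End.mul_apply] at h1
  rw [h1, LinearMap.add_apply, map_add, Module.End.mul_apply, coeff_cart, LinearMap.smul_apply,
    map_smul, (mem_radical α lam).1 hm w]
  simp

/-- The lowering operator is exchanged with the rightmost raising operator of the word. The Cartan
term stays in the radical, and in the other term the word is shorter. For the empty word, `coeff`
vanishes on the image of `lower`. -/
theorem lower_mem_radical (i : Fin 3) :
    radical α lam ≤ (radical α lam).comap (lower i) := by
  intro m hm
  rw [Submodule.mem_comap, mem_radical]
  intro w
  induction w using List.reverseRecOn generalizing m with
  | nil => simp [coeff_lower]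
  | append_singleton w j ih =>
    have h1 := LinearMap.congr_fun ((chevalley α lam).raise_mul_lower j i) m
    rw [Module.End.mul_apply, LinearMap.add_apply, LinearMap.smul_apply, Module.End.mul_apply] at h1
    rw [List.map_append, List.prod_append, Module.End.mul_apply, List.map_singleton,
      List.prod_singleton, h1, map_add, map_add, map_smul, map_smul,
      ih (raise_mem_radical α lam j hm), smul_zero, zero_add]
    split_ifs
    · exact (mem_radical α lam).1 (cart_mem_radical α lam _ hm) w
    · simp

/-- The quotient by the radical. -/
abbrev Quot : Type := FreeVerma ⧸ radical α lam

/-- The raising operators on the quotient. -/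
noncomputable def qraise (i : Fin 3) : Module.End ℂ (Quot α lam) :=
  (radical α lam).mapQ _ (raise α lam i) (raise_mem_radical α lam i)

/-- The lowering operators on the quotient. -/
noncomputable def qlower (i : Fin 3) : Module.End ℂ (Quot α lam) :=
  (radical α lam).mapQ _ (lower i) (lower_mem_radical α lam i)

/-- The action of the Cartan subalgebra on the quotient. -/
noncomputable def qcart : cartan →ₗ[ℂ] Module.End ℂ (Quot α lam) where
  toFun t := (radical α lam).mapQ _ (cart lam t) (cart_mem_radical α lam t)
  map_add' s t := by
    apply Submodule.linearMap_qext
    ext w : 2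
    simp
  map_smul' c t := by
    apply Submodule.linearMap_qext
    ext w : 2
    simp

theorem qraise_mk (i : Fin 3) (m : FreeVerma) :
    qraise α lam i ((radical α lam).mkQ m) = (radical α lam).mkQ (raise α lam i m) := rfl

theorem qlower_mk (i : Fin 3) (m : FreeVerma) :
    qlower α lam i ((radical α lam).mkQ m) = (radical α lam).mkQ (lower i m) := rfl

theorem qcart_mk (t : cartan) (m : FreeVerma) :
    qcart α lam t ((radical α lam).mkQ m) = (radical α lam).mkQ (cart lam t m) := rfl

theorem chevalley_quot : Chevalley α (qcart α lam) (qraise α lam) (qlower α lam) where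
  comm s t := by
    apply Submodule.linearMap_qext
    apply LinearMap.ext; intro m
    simp only [LinearMap.comp_apply, Module.End.mul_apply, qcart_mk]
    congr 1
    exact LinearMap.congr_fun ((chevalley α lam).comm s t) m
  weight_raise t i := by
    apply Submodule.linearMap_qext
    apply LinearMap.ext; intro m
    have h1 := LinearMap.congr_fun ((chevalley α lam).weight_raise t i) m
    simp only [Module.End.mul_apply, LinearMap.add_apply, LinearMap.smul_apply] at h1
    simp only [LinearMap.comp_apply, Module.End.mul_apply, qcart_mk, qraise_mk,
      LinearMap.add_apply, LinearMap.smul_apply]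
    rw [h1, map_add, map_smul]
  weight_lower t i := by
    apply Submodule.linearMap_qext
    apply LinearMap.ext; intro m
    have h1 := LinearMap.congr_fun ((chevalley α lam).weight_lower t i) m
    simp only [Module.End.mul_apply, LinearMap.sub_apply, LinearMap.smul_apply] at h1
    simp only [LinearMap.comp_apply, Module.End.mul_apply, qcart_mk, qlower_mk,
      LinearMap.sub_apply, LinearMap.smul_apply]
    rw [h1, map_sub, map_smul]
  cross i j := by
    apply Submodule.linearMap_qext
    apply LinearMap.ext; intro m
    have h1 := LinearMap.congr_fun ((chevalley α lam).cross i j) m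
    simp only [LinearMap.comp_apply, Module.End.mul_apply, qraise_mk, qlower_mk,
      LinearMap.add_apply, ← map_add]
    simp only [Module.End.mul_apply, LinearMap.add_apply] at h1
    rw [h1]
    split_ifs
    · rfl
    · simp

/-- The coefficient of the empty word, on the quotient. -/
noncomputable def qcoeff : Quot α lam →ₗ[ℂ] ℂ :=
  (radical α lam).liftQ coeff fun m hm => by simpa using (mem_radical α lam).1 hm []

theorem qcoeff_qlower (i : Fin 3) (m : Quot α lam) : qcoeff α lam (qlower α lam i m) = 0 := by
  obtain ⟨m, rfl⟩ := Submodule.mkQ_surjective _ m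
  exact coeff_lower i m

/-- The image of the empty word. -/
noncomputable def vac : Quot α lam := (radical α lam).mkQ (Finsupp.single [] 1)

theorem qcoeff_vac : qcoeff α lam (vac α lam) = 1 := by
  change coeff (Finsupp.single [] 1) = 1
  simp [coeff]

theorem qraise_vac (i : Fin 3) : qraise α lam i (vac α lam) = 0 := by
  rw [vac, qraise_mk, raise_single, raiseWord, map_zero]

theorem qcart_vac (t : cartan) : qcart α lam t (vac α lam) = lam t • vac α lam := by
  rw [vac, qcart_mk, cart_single, map_smul]
  simp [wordWeight]

/-- An operator that commutes with the lowering operators up to a scalar and kills the vacuum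
vector is zero. -/
theorem eq_zero_of_lower (S : Module.End ℂ (Quot α lam)) (c : ℂ)
    (hS : ∀ j, S * qlower α lam j = c • (qlower α lam j * S)) (hv : S (vac α lam) = 0) :
    S = 0 := by
  apply Submodule.linearMap_qext
  ext w : 2
  change S ((radical α lam).mkQ (Finsupp.single w 1)) = 0
  induction w with
  | nil => exact hv
  | cons j w ih =>
    have h1 := LinearMap.congr_fun (hS j) ((radical α lam).mkQ (Finsupp.single w 1))
    rw [Module.End.mul_apply, qlower_mk, lower_single] at h1
    rw [h1, LinearMap.smul_apply, Module.End.mul_apply, ih, map_zero, smul_zero]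

/-- An operator that commutes with the raising operators up to a scalar and whose image has zero
coefficients of the vacuum vector is zero. -/
theorem eq_zero_of_raise (S : Module.End ℂ (Quot α lam)) (c : ℂ)
    (hS : ∀ j, S * qraise α lam j = c • (qraise α lam j * S)) (hc : c ≠ 0)
    (hv : ∀ m, qcoeff α lam (S m) = 0) : S = 0 := by
  have key : ∀ (w : List (Fin 3)) (m : Quot α lam),
      qcoeff α lam ((w.map (qraise α lam)).prod (S m)) = 0 := by
    intro w
    induction w using List.reverseRecOn with
    | nil => exact hv
    | append_singleton w j ih =>
      intro m
      have h1 := LinearMap.congr_fun (hS j) m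
      rw [Module.End.mul_apply, LinearMap.smul_apply, Module.End.mul_apply] at h1
      have h2 := ih (qraise α lam j m)
      rw [h1, map_smul, map_smul, smul_eq_zero] at h2
      simpa using h2.resolve_left hc
  have hw : ∀ (w : List (Fin 3)) (m : FreeVerma), (w.map (qraise α lam)).prod
      ((radical α lam).mkQ m) = (radical α lam).mkQ ((w.map (raise α lam)).prod m) := by
    intro w m
    induction w with
    | nil => rfl
    | cons j w ih =>
      rw [List.map_cons, List.prod_cons, Module.End.mul_apply, ih, qraise_mk]
      simp
  apply LinearMap.ext
  intro m
  obtain ⟨n, hn⟩ := Submodule.mkQ_surjective _ (S m)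
  rw [← hn, LinearMap.zero_apply, Submodule.mkQ_apply, Submodule.Quotient.mk_eq_zero, mem_radical]
  intro w
  have := key w m
  rw [← hn, hw] at this
  exact this

/-- Each Serre expression in the raising operators commutes or anticommutes with every lowering
operator and kills the vacuum, so it is zero on the words that span the quotient. Dually, each one
in the lowering operators commutes or anticommutes with every raising operator and has image without
vacuum component. Such an image lies in the radical. -/
theorem chevalleySerre_quot (hα₀ : α ≠ 0) (hα₁ : α ≠ -1) :
    ChevalleySerre α (qcart α lam) (qraise α lam) (qlower α lam) where
  toChevalley := chevalley_quot α lam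
  sq_raise i := by
    refine eq_zero_of_lower α lam _ 1 (fun j => ?_) ?_
    · rw [one_smul, (chevalley_quot α lam).sq_raise_mul i j]
    · rw [Module.End.mul_apply, qraise_vac, map_zero]
  sq_lower i := by
    refine eq_zero_of_raise α lam _ 1 (fun j => ?_) one_ne_zero fun m => qcoeff_qlower α lam _ _
    rw [one_smul, (chevalley_quot α lam).sq_lower_mul i j]
  top_raise i := by
    refine sub_eq_zero.1 ?_
    refine eq_zero_of_lower α lam _ (-1)
      (fun j => (chevalley_quot α lam).topVec_sub_mul_lower hα₀ hα₁ i 0 j) ?_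
    simp [topVec, evenVec, qraise_vac]
  top_lower i := by
    refine sub_eq_zero.1 ?_
    refine eq_zero_of_raise α lam _ (-1)
      (fun j => (chevalley_quot α lam).topVec_sub_mul_raise hα₀ hα₁ i 0 j) (by norm_num) fun m => ?_
    simp [topVec, evenVec, qcoeff_qlower]

end FreeVerma

end D21

/-! ### The Verma module and its simple quotient. -/

namespace D21

open LieSuperalgebra

/-- The Cartan subalgebra in the enveloping algebra. -/
noncomputable def cartanι (α : ℂ) : cartan →ₗ[ℂ] Env (g α) :=
  evenι (g α) ∘ₗ cartan.subtype

/-- The Chevalley generators `eᵢ` in the enveloping algebra. -/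
noncomputable def eι (α : ℂ) (i : Fin 3) : Env (g α) := oddι (g α) (e i)

/-- The Chevalley generators `fᵢ` in the enveloping algebra. -/
noncomputable def fι (α : ℂ) (i : Fin 3) : Env (g α) := oddι (g α) (f i)

theorem cartanι_mul_oddι {α : ℂ} {t : cartan} {v : Odd} {c : ℂ} (h : act t.1 v = c • v) :
    cartanι α t * oddι (g α) v = oddι (g α) v * cartanι α t + c • oddι (g α) v := by
  have := evenι_mul_oddι (g α) t.1 v
  rw [show (g α).eo t.1 v = c • v from h, map_smul] at this
  rw [← this]
  exact (add_sub_cancel _ _).symm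

theorem cartanι_mul_evenι {α : ℂ} {t : cartan} {x : Even} {c : ℂ}
    (h : (g α).ee t.1 x = c • x) :
    cartanι α t * evenι (g α) x = evenι (g α) x * cartanι α t + c • evenι (g α) x := by
  have := evenι_mul_evenι (g α) t.1 x
  rw [h, map_smul] at this
  rw [← this]
  exact (add_sub_cancel _ _).symm

theorem eq_sub_of_eq_add_neg_smul {A : Type*} [AddCommGroup A] [Module ℂ A] {a b d : A} {c : ℂ}
    (h : a = b + -c • d) : a = b - c • d := by
  rw [h, neg_smul, ← sub_eq_add_neg]

theorem chevalley_env (α : ℂ) : Chevalley α (cartanι α) (eι α) (fι α) where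
  comm s t := by
    have h0 : (g α).ee s.1 t.1 = (0 : ℂ) • t.1 := by
      change evenBracketₗ s.1 t.1 = _
      have k0 := fun j => (s.2 j).1
      have k1 := fun j => (s.2 j).2
      have k2 := fun j => (t.2 j).1
      have k3 := fun j => (t.2 j).2
      apply even_ext <;> intro j <;> rw [evenBracket_apply, smul_entry] <;>
        simp [k0, k1, k2, k3, mul_comm]
    have := cartanι_mul_evenι h0
    rwa [zero_smul, add_zero] at this
  weight_raise t i := cartanι_mul_oddι (act_e t i)
  weight_lower t i := by
    exact eq_sub_of_eq_add_neg_smul (cartanι_mul_oddι (α := α) (act_f t i))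
  cross i j := by
    rw [eι, fι, oddι_mul_oddι, (D21.chevalley α i j).2.2]
    split_ifs
    · rfl
    · exact map_zero _

theorem Chevalley.triangular {α : ℂ} {A : Type*} [Ring A] [Algebra ℂ A] {η : cartan →ₗ[ℂ] A}
    {x y : Fin 3 → A} (C : Chevalley α η x y) :
    Triangular η x y (h α) beta (fun _ _ => -1) where
  raise_lower i j := by
    rw [C.raise_mul_lower]
  weight := C.weight_lower

/-- The element of the Cartan subalgebra that takes the value `1` on all simple roots. -/
noncomputable def grading (α : ℂ) : cartan := H α 0 + H α 1 + H α 2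

theorem beta_grading (α : ℂ) (i : Fin 3) : beta i (grading α) = 1 := by
  rw [grading, map_add, map_add, beta_H, beta_H, beta_H]
  revert i
  refine forall_fin_three ?_ ?_ ?_ <;> simp

theorem grading_entry (α : ℂ) (j : Fin 3) : ((grading α).1 j).1 0 0 = 1 ∧
    ((grading α).1 j).1 0 1 = 0 ∧ ((grading α).1 j).1 1 0 = 0 := by
  refine ⟨?_, (grading α).2 j⟩
  simp only [grading, Submodule.coe_add, add_entry, H_apply]
  revert j
  refine forall_fin_three ?_ ?_ ?_ <;> simp

theorem degree_of_mem_pos (α : ℂ) {γ : Module.Dual ℂ cartan} (hγ : γ ∈ pos) :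
    ∃ n : ℕ, γ (grading α) = (n + 1 : ℕ) := by
  rcases hγ with (rfl | rfl | rfl) | (rfl | rfl | rfl | rfl) <;>
    simp only [LinearMap.add_apply, beta_grading]
  · exact ⟨1, by norm_num⟩
  · exact ⟨1, by norm_num⟩
  · exact ⟨1, by norm_num⟩
  · exact ⟨0, by norm_num⟩
  · exact ⟨0, by norm_num⟩
  · exact ⟨0, by norm_num⟩
  · exact ⟨2, by norm_num⟩

theorem oo_e (α : ℂ) (i : Fin 3) :
    (g α).oo (e (i + 1)) (e (i + 2)) = (-2 * sigma α i) • E i := by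
  change oddBracket α (e (i + 1)) (e (i + 2)) = _
  revert i
  refine forall_fin_three ?_ ?_ ?_ <;> apply even_ext <;> refine forall_fin_three ?_ ?_ ?_ <;>
    simp [oddBracket_00, oddBracket_01, oddBracket_10, E_apply, e, tens, contr_zero,
      contr_one, contr_two]

theorem eo_E (α : ℂ) : (g α).eo (E 0) (e 0) = tens 0 0 0 := by
  change act (E 0) (e 0) = _
  apply odd_ext
  simp only [Fin.forall_fin_two]
  simp [act_apply, E_apply, e, tens]

section

variable {α : ℂ} {M : Type*} [AddCommGroup M] [Module ℂ M] [Module (Env (g α)) M]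
  [IsScalarTower ℂ (Env (g α)) M] {v : M}

/-- `Eᵢ` is a nonzero multiple of `[e_{i+1}, e_{i+2}]`. -/
theorem E_smul_eq_zero (hα₀ : α ≠ 0) (hα₁ : α ≠ -1) (i : Fin 3) (h1 : eι α (i + 1) • v = 0)
    (h2 : eι α (i + 2) • v = 0) : evenι (g α) (E i) • v = 0 := by
  have h3 := congrArg (fun u => u • v) (oddι_mul_oddι (g α) (e (i + 1)) (e (i + 2)))
  have hs : -2 * sigma α i ≠ 0 := mul_ne_zero (by norm_num) (sigma_ne_zero hα₀ hα₁ i)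
  rw [eι] at h1 h2
  simp only [add_smul, mul_smul, h1, h2, smul_zero, add_zero, oo_e, map_smul, smul_assoc] at h3
  exact ((smul_eq_zero_iff_right (left_ne_zero_of_mul hs)).1
    ((smul_eq_zero_iff_right (right_ne_zero_of_mul hs)).1 (by
      rw [smul_comm, ← smul_assoc, smul_eq_mul, mul_smul]; exact h3.symm)))

theorem tens_smul_eq_zero (hα₀ : α ≠ 0) (hα₁ : α ≠ -1) (hv : ∀ i, eι α i • v = 0) :
    oddι (g α) (tens 0 0 0) • v = 0 := by
  have h0 := hv 0
  rw [eι] at h0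
  rw [← eo_E α, ← evenι_mul_oddι, sub_smul, mul_smul, mul_smul, h0,
    E_smul_eq_zero hα₀ hα₁ 0 (hv _) (hv _), smul_zero, smul_zero, sub_zero]

/-- A positive root takes a positive integral value on the grading element. In the even part this
element has eigenvalues `2, 0, -2`, so only the span of the `Eⱼ` can contribute. The odd case below
is the same with degrees `3, 1, -1, -3`. -/
theorem even_pos_smul_eq_zero (hα₀ : α ≠ 0) (hα₁ : α ≠ -1) (hv : ∀ i, eι α i • v = 0)
    {γ : Module.Dual ℂ cartan} (hγ : γ ∈ pos) {x : Even}
    (hx : x ∈ evenRootSpace (g α) cartan γ) : evenι (g α) x • v = 0 := by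
  obtain ⟨n, hn⟩ := degree_of_mem_pos α hγ
  have h1 : evenBracketₗ (grading α).1 x = γ (grading α) • x := hx (grading α)
  have h2 : ∀ j a b, (evenBracketₗ (grading α).1 x j).1 a b = ((n + 1 : ℕ) : ℂ) * (x j).1 a b :=
    fun j a b => by rw [h1, smul_entry, hn]
  simp only [evenBracket_apply] at h2
  have h00 : ∀ j, (x j).1 0 0 = 0 := fun j => by
    obtain ⟨k0, k1, k2⟩ := grading_entry α j
    have := h2 j 0 0
    rw [k0, k1, k2] at this
    have h4 : ((n + 1 : ℕ) : ℂ) * (x j).1 0 0 = 0 := by linear_combination -this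
    exact (mul_eq_zero.1 h4).resolve_left (Nat.cast_ne_zero.2 (by omega))
  have h10 : ∀ j, (x j).1 1 0 = 0 := fun j => by
    obtain ⟨k0, k1, k2⟩ := grading_entry α j
    have := h2 j 1 0
    rw [trace_zero (grading α).1 j, k0, k2] at this
    have h4 : ((n + 1 + 2 : ℕ) : ℂ) * (x j).1 1 0 = 0 := by
      push_cast at this ⊢
      linear_combination -this
    exact (mul_eq_zero.1 h4).resolve_left (Nat.cast_ne_zero.2 (by omega))
  have hx' : x = ∑ j, (x j).1 0 1 • E j := by
    rw [Fin.sum_univ_three]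
    apply even_ext <;> refine forall_fin_three ?_ ?_ ?_ <;>
      simp [E_apply, h00, h10]
  rw [hx', map_sum, Finset.sum_smul]
  refine Finset.sum_eq_zero fun j _ => ?_
  rw [map_smul, smul_assoc, E_smul_eq_zero hα₀ hα₁ j (hv _) (hv _), smul_zero]

theorem odd_pos_smul_eq_zero (hα₀ : α ≠ 0) (hα₁ : α ≠ -1) (hv : ∀ i, eι α i • v = 0)
    {γ : Module.Dual ℂ cartan} (hγ : γ ∈ pos) {x : Odd}
    (hx : x ∈ oddRootSpace (g α) cartan γ) : oddι (g α) x • v = 0 := by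
  obtain ⟨n, hn⟩ := degree_of_mem_pos α hγ
  have h1 : act (grading α).1 x = γ (grading α) • x := hx (grading α)
  have h2 : ∀ a b c, act (grading α).1 x a b c = ((n + 1 : ℕ) : ℂ) * x a b c :=
    fun a b c => by rw [h1, hn]; rfl
  have k0 := fun j => (grading_entry α j).1
  have k1 := fun j => (grading_entry α j).2.1
  have k2 := fun j => (grading_entry α j).2.2
  simp only [act_apply] at h2
  have key : ∀ (m : ℕ) (z : ℂ), ((n + 1 : ℕ) : ℂ) * z = -(m * z) → z = 0 := by
    intro m z hz
    have h4 : ((n + 1 + m : ℕ) : ℂ) * z = 0 := by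
      push_cast at hz ⊢
      linear_combination hz
    exact (mul_eq_zero.1 h4).resolve_left (Nat.cast_ne_zero.2 (by omega))
  -- The coordinates of the `fᵢ` have degree `-1`, and that of the lowest tensor has degree `-3`.
  have z1 : x 0 1 1 = 0 := key 1 _ (by rw [← h2]; simp only [trace_zero, k0, k1, k2]; ring)
  have z2 : x 1 0 1 = 0 := key 1 _ (by rw [← h2]; simp only [trace_zero, k0, k1, k2]; ring)
  have z3 : x 1 1 0 = 0 := key 1 _ (by rw [← h2]; simp only [trace_zero, k0, k1, k2]; ring)
  have z4 : x 1 1 1 = 0 := key 3 _ (by rw [← h2]; simp only [trace_zero, k0, k2]; ring)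
  have hx' : x = x 0 0 0 • tens 0 0 0 + (x 1 0 0 • e 0 + x 0 1 0 • e 1 + x 0 0 1 • e 2) := by
    apply odd_ext
    simp only [Fin.forall_fin_two]
    simp [e, tens, z1, z2, z3, z4]
  have hv' : ∀ i, oddι (g α) (e i) • v = 0 := hv
  rw [hx']
  simp only [map_add, map_smul, add_smul, smul_assoc, tens_smul_eq_zero hα₀ hα₁ hv, hv',
    smul_zero, add_zero]

theorem smul_eq_of_sub_algebraMap_smul {u : Env (g α)} {c : ℂ}
    (h : (u - algebraMap ℂ (Env (g α)) c) • v = 0) : u • v = c • v := by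
  rwa [sub_smul, algebraMap_smul, sub_eq_zero] at h

/-- The Verma module maps to every module with a highest weight vector. -/
theorem vermaIdeal_smul_eq_zero (hα₀ : α ≠ 0) (hα₁ : α ≠ -1) {lam : Module.Dual ℂ cartan}
    (hv : ∀ i, eι α i • v = 0) (hw : ∀ t, cartanι α t • v = lam t • v) :
    vermaIdeal (g α) cartan pos lam ≤
      LinearMap.ker (LinearMap.toSpanSingleton (Env (g α)) M v) := by
  refine Submodule.span_le.2 ?_
  rintro u ((⟨γ, hγ, x, hx, rfl⟩ | ⟨γ, hγ, x, hx, rfl⟩) | ⟨t, rfl⟩) <;>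
    rw [SetLike.mem_coe, LinearMap.mem_ker, LinearMap.toSpanSingleton_apply]
  · exact even_pos_smul_eq_zero hα₀ hα₁ hv hγ hx
  · exact odd_pos_smul_eq_zero hα₀ hα₁ hv hγ hx
  · rw [sub_smul, algebraMap_smul]
    exact sub_eq_zero.2 (hw t)

end

section

variable (α : ℂ) (lam : Module.Dual ℂ cartan)

/-- The highest weight vector of the Verma module. -/
noncomputable def vermaVec : Verma (g α) cartan pos lam := Submodule.Quotient.mk 1

theorem smul_vermaVec (u : Env (g α)) :
    u • vermaVec α lam = Submodule.Quotient.mk u := by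
  rw [vermaVec, ← Submodule.Quotient.mk_smul, smul_eq_mul, mul_one]

theorem e_mem_oddRootSpace (i : Fin 3) : e i ∈ oddRootSpace (g α) cartan (beta i) :=
  fun t => act_e t i

theorem beta_mem_pos (i : Fin 3) : beta i ∈ pos := by
  refine Or.inr ?_
  revert i
  refine forall_fin_three ?_ ?_ ?_ <;> simp [oddPos]

theorem eι_smul_vermaVec (i : Fin 3) : eι α i • vermaVec α lam = 0 := by
  rw [smul_vermaVec, Submodule.Quotient.mk_eq_zero]
  exact Submodule.subset_span
    (Or.inl (Or.inr ⟨beta i, beta_mem_pos i, e i, e_mem_oddRootSpace α i, rfl⟩))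

theorem cartanι_smul_vermaVec (t : cartan) :
    cartanι α t • vermaVec α lam = lam t • vermaVec α lam := by
  refine smul_eq_of_sub_algebraMap_smul (M := Verma (g α) cartan pos lam) (v := vermaVec α lam)
    (u := cartanι α t) (c := lam t) ?_
  rw [smul_vermaVec, Submodule.Quotient.mk_eq_zero]
  exact Submodule.subset_span (Or.inr ⟨t, rfl⟩)

variable {α}

theorem mem_wordSpan_of_generators {M : Type*} [AddCommGroup M] [Module ℂ M]
    [Module (Env (g α)) M] [IsScalarTower ℂ (Env (g α)) M] {lam : Module.Dual ℂ cartan}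
    (hα₀ : α ≠ 0) (hα₁ : α ≠ -1) {v : M}
    (hv : ∀ i, eι α i • v = 0) (hw : ∀ t, cartanι α t • v = lam t • v) (u : Env (g α)) :
    u • v ∈ wordSpan (fι α) v := by
  refine env_smul_mem_of_generators hα₀ hα₁ _ (fun i m hm => ?_)
    (fun i m hm => lower_smul_mem_wordSpan i hm) u _ (self_mem_wordSpan _ _)
  exact (chevalley_env α).triangular.raise_smul_mem_wordSpan hw hv i hm

/-- A proper submodule of a highest weight module has no component in the highest weight space. -/
theorem mem_span_lower_of_ne_top {M : Type*} [AddCommGroup M] [Module ℂ M]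
    [Module (Env (g α)) M] [IsScalarTower ℂ (Env (g α)) M] {lam : Module.Dual ℂ cartan}
    (hα₀ : α ≠ 0) (hα₁ : α ≠ -1) {v : M}
    (hv : ∀ i, eι α i • v = 0) (hw : ∀ t, cartanι α t • v = lam t • v)
    (hgen : ∀ m, ∃ u : Env (g α), u • v = m) {N : Submodule (Env (g α)) M} (hN : N ≠ ⊤)
    {n : M} (hn : n ∈ N) :
    n ∈ Submodule.span ℂ {m | ∃ (a : Fin 3) (m' : M), m = fι α a • m'} := by
  obtain ⟨u, hu⟩ := hgen n
  have hmem := mem_wordSpan_of_generators hα₀ hα₁ hv hw u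
  rw [hu] at hmem
  obtain ⟨c, n', hc, hn', p, hp, hp'⟩ :=
    (chevalley_env α).triangular.exists_decomposition hw
      (d := grading α) (k := fun _ => 1) (fun a => by simp [beta_grading]) (by simp) hmem
  -- Applying `p` of the grading element to `n` removes `n'` and leaves a multiple of `v` by `c *
  -- p.eval (lam (grading α))`. If `c ≠ 0` this puts `v` into `N`, so `N` is everything.
  have hc0 : c = 0 := by
    by_contra hc0
    apply hN
    have h1 : Polynomial.aeval (cartanι α (grading α)) p • n ∈ N := N.smul_mem _ hn
    have : SMulCommClass (Env (g α)) ℂ M := IsScalarTower.to_smulCommClass'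
    rw [hc, smul_add, hp', add_zero, smul_comm, aeval_smul_of_eigenvector (hw _), smul_smul] at h1
    have h2 := N.smul_mem (algebraMap ℂ (Env (g α)) (c * p.eval (lam (grading α)))⁻¹) h1
    rw [algebraMap_smul, inv_smul_smul₀ (mul_ne_zero hc0 hp)] at h2
    rw [eq_top_iff]
    intro m _
    obtain ⟨w, rfl⟩ := hgen m
    exact N.smul_mem _ h2
  rwa [hc, hc0, zero_smul, zero_add]

/-- The highest weight vector of the Verma module does not lie in the sum of all proper
submodules. -/
theorem vermaVec_not_mem_vermaMax (hα₀ : α ≠ 0) (hα₁ : α ≠ -1) :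
    vermaVec α lam ∉ vermaMax (g α) cartan pos lam := by
  obtain ⟨Φ, hΦt, hΦe, hΦf⟩ := (FreeVerma.chevalleySerre_quot α lam hα₀ hα₁).exists_env_hom hα₀ hα₁
  let _ : Module (Env (g α)) (FreeVerma.Quot α lam) :=
    Module.compHom (FreeVerma.Quot α lam) Φ.toRingHom
  have hsmul : ∀ (u : Env (g α)) (m : FreeVerma.Quot α lam), u • m = Φ u m := fun _ _ => rfl
  have : IsScalarTower ℂ (Env (g α)) (FreeVerma.Quot α lam) := ⟨fun c u m => by
    rw [hsmul, hsmul, map_smul, LinearMap.smul_apply]⟩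
  have hker := vermaIdeal_smul_eq_zero (v := FreeVerma.vac α lam) (lam := lam) hα₀ hα₁
    (fun i => by rw [hsmul, eι, hΦe, FreeVerma.qraise_vac])
    (fun t => by
      rw [hsmul, ← FreeVerma.qcart_vac, ← hΦt]; rfl)
  let π : Verma (g α) cartan pos lam →ₗ[Env (g α)] FreeVerma.Quot α lam :=
    (vermaIdeal (g α) cartan pos lam).liftQ _ hker
  have hπ : π (vermaVec α lam) = FreeVerma.vac α lam := by
    change Φ 1 (FreeVerma.vac α lam) = _
    rw [map_one, Module.End.one_apply]
  -- `Q` is the largest submodule on which the vacuum coefficient, pulled back along `π`, vanishes.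
  -- It contains every proper submodule, hence their sum, but not the highest weight vector.
  let Q : Submodule (Env (g α)) (Verma (g α) cartan pos lam) :=
    { carrier := {n | ∀ u : Env (g α), FreeVerma.qcoeff α lam (π (u • n)) = 0}
      zero_mem' := by simp
      add_mem' := by
        intro a b ha hb u
        rw [smul_add, map_add, map_add, ha, hb, add_zero]
      smul_mem' := by
        intro c a ha u
        rw [smul_smul, ha] }
  have hQ : vermaMax (g α) cartan pos lam ≤ Q := by
    refine sSup_le fun N hN => ?_
    have key : ∀ n ∈ N, FreeVerma.qcoeff α lam (π n) = 0 := by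
      intro n hn
      have hn' := mem_span_lower_of_ne_top hα₀ hα₁ (eι_smul_vermaVec α lam)
        (cartanι_smul_vermaVec α lam) (fun m => by
          obtain ⟨w, rfl⟩ := Submodule.Quotient.mk_surjective _ m
          exact ⟨w, smul_vermaVec α lam w⟩) hN hn
      clear hn
      induction hn' using Submodule.span_induction with
      | mem m hm =>
        obtain ⟨a, m', rfl⟩ := hm
        rw [map_smul, hsmul, fι, hΦf, FreeVerma.qcoeff_qlower]
      | zero => simp
      | add a b _ _ ha hb => rw [map_add, map_add, ha, hb, add_zero]
      | smul r m _ hm =>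
        rw [← algebraMap_smul (Env (g α)) r m, map_smul, algebraMap_smul, map_smul, hm, smul_zero]
    intro n hn u
    exact key _ (N.smul_mem u hn)
  intro hmem
  have := hQ hmem 1
  rw [one_smul, hπ, FreeVerma.qcoeff_vac] at this
  exact one_ne_zero this

/-- The highest weight vector of the simple module. -/
noncomputable def simpleVec (α : ℂ) (lam : Module.Dual ℂ cartan) :
    SimpleHW (g α) cartan pos lam := Submodule.Quotient.mk (vermaVec α lam)

theorem simpleVec_ne_zero (hα₀ : α ≠ 0) (hα₁ : α ≠ -1) : simpleVec α lam ≠ 0 := by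
  rw [simpleVec, Ne, Submodule.Quotient.mk_eq_zero]
  exact vermaVec_not_mem_vermaMax lam hα₀ hα₁

theorem eι_smul_simpleVec (i : Fin 3) : eι α i • simpleVec α lam = 0 := by
  rw [simpleVec, ← Submodule.Quotient.mk_smul, eι_smul_vermaVec, Submodule.Quotient.mk_zero]

theorem cartanι_smul_simpleVec (t : cartan) :
    cartanι α t • simpleVec α lam = lam t • simpleVec α lam := by
  rw [simpleVec, ← Submodule.Quotient.mk_smul, cartanι_smul_vermaVec, Submodule.Quotient.mk_smul]

/-- The preimage of a proper submodule is proper, hence contained in the sum of all proper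
submodules, so its image is zero. -/
theorem simpleHW_eq_top {N : Submodule (Env (g α)) (SimpleHW (g α) cartan pos lam)}
    (hN : N ≠ ⊥) : N = ⊤ := by
  by_contra hN'
  apply hN
  have h1 : N.comap (Submodule.mkQ _) ≤ vermaMax (g α) cartan pos lam := by
    refine le_sSup fun h => hN' ?_
    rw [eq_top_iff]
    intro m _
    obtain ⟨n, rfl⟩ := Submodule.mkQ_surjective _ m
    have : n ∈ N.comap (Submodule.mkQ _) := h ▸ Submodule.mem_top
    exact this
  rw [eq_bot_iff]
  intro m hm
  obtain ⟨n, rfl⟩ := Submodule.mkQ_surjective _ m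
  rw [Submodule.mem_bot, Submodule.mkQ_apply, Submodule.Quotient.mk_eq_zero]
  exact h1 hm

end

end D21

/-! ### Odd reflections and injectivity of the `Fᵢ`. -/

namespace D21

open LieSuperalgebra

theorem act_E_e (i j : Fin 3) (hij : i ≠ j) : act (E i) (e j) = 0 := by
  apply odd_ext
  simp only [Fin.forall_fin_two]
  revert i j
  refine forall_fin_three ?_ ?_ ?_ <;> refine forall_fin_three ?_ ?_ ?_ <;>
    simp [act_apply, E_apply, e, tens]

theorem act_F_f (i j : Fin 3) (hij : i ≠ j) : act (F i) (f j) = 0 := by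
  apply odd_ext
  simp only [Fin.forall_fin_two]
  revert i j
  refine forall_fin_three ?_ ?_ ?_ <;> refine forall_fin_three ?_ ?_ ?_ <;>
    simp [act_apply, F_apply, f, tens]

theorem act_E_f (i j : Fin 3) (hij : i ≠ j) : act (E i) (f j) = (1 / 2 : ℂ) • e (-(i + j)) := by
  apply odd_ext
  simp only [Fin.forall_fin_two]
  revert i j
  refine forall_fin_three ?_ ?_ ?_ <;> refine forall_fin_three ?_ ?_ ?_ <;>
    simp [act_apply, E_apply, e, f, tens, neg_one_eq, neg_two_eq]

theorem act_F_e (i j : Fin 3) (hij : i ≠ j) : act (F i) (e j) = (2 : ℂ) • f (-(i + j)) := by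
  apply odd_ext
  simp only [Fin.forall_fin_two]
  revert i j
  refine forall_fin_three ?_ ?_ ?_ <;> refine forall_fin_three ?_ ?_ ?_ <;>
    simp [act_apply, F_apply, e, f, tens, neg_one_eq, neg_two_eq]

theorem act_F_act_F (i : Fin 3) (v : Odd) : act (F i) (act (F i) v) = 0 := by
  apply odd_ext
  simp only [Fin.forall_fin_two]
  revert i
  refine forall_fin_three ?_ ?_ ?_ <;> simp [act_apply, F_apply]

theorem ee_E_F (i j : Fin 3) (hij : i ≠ j) : evenBracketₗ (E i) (F j) = 0 := by
  apply even_ext <;> intro k <;> rw [evenBracket_apply] <;>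
    simp [E_apply, F_apply]
  all_goals
    intro h1 h2
    exact absurd (h1.symm.trans h2) (by first | exact hij | exact hij.symm)

theorem oo_f_self (α : ℂ) (j : Fin 3) : oddBracket α (f j) (f j) = 0 := by
  revert j
  refine forall_fin_three ?_ ?_ ?_ <;> apply even_ext <;> refine forall_fin_three ?_ ?_ ?_ <;>
    simp [oddBracket_00, oddBracket_01, oddBracket_10, f, tens, contr_zero, contr_one, contr_two]

theorem evenSimple_H (α : ℂ) (i j : Fin 3) : evenSimple i (H α j) = if i = j then 2 else 0 := by
  rw [evenSimple_apply, H_apply]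
  simp

/-- The root vectors `Eᵢ` in the enveloping algebra. -/
noncomputable def Eι (α : ℂ) (i : Fin 3) : Env (g α) := evenι (g α) (E i)

/-- The root vectors `Fᵢ` in the enveloping algebra. -/
noncomputable def Fι (α : ℂ) (i : Fin 3) : Env (g α) := evenι (g α) (F i)

theorem Eι_mul_Fι (α : ℂ) (i j : Fin 3) :
    Eι α i * Fι α j = Fι α j * Eι α i + if i = j then cartanι α (H α i) else 0 := by
  have h1 := evenι_mul_evenι (g α) (E i) (F j)
  rw [Eι, Fι, ← sub_eq_iff_eq_add', h1]
  split_ifs with hij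
  · subst hij; rfl
  · rw [show (g α).ee (E i) (F j) = 0 from ee_E_F i j hij, map_zero]

theorem cartanι_mul_Fι (α : ℂ) (t : cartan) (i : Fin 3) :
    cartanι α t * Fι α i = Fι α i * cartanι α t - evenSimple i t • Fι α i :=
  eq_sub_of_eq_add_neg_smul (cartanι_mul_evenι ((sl2_triple α i).2.1 t))

theorem Eι_mul_eι (α : ℂ) {i j : Fin 3} (hij : i ≠ j) : Eι α i * eι α j = eι α j * Eι α i := by
  have h1 := evenι_mul_oddι (g α) (E i) (e j)
  rw [show (g α).eo (E i) (e j) = 0 from act_E_e i j hij, map_zero] at h1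
  exact sub_eq_zero.1 h1

theorem Fι_mul_fι (α : ℂ) {i j : Fin 3} (hij : i ≠ j) : Fι α i * fι α j = fι α j * Fι α i := by
  have h1 := evenι_mul_oddι (g α) (F i) (f j)
  rw [show (g α).eo (F i) (f j) = 0 from act_F_f i j hij, map_zero] at h1
  exact sub_eq_zero.1 h1

theorem Eι_mul_fι (α : ℂ) {i j : Fin 3} (hij : i ≠ j) :
    Eι α i * fι α j - fι α j * Eι α i = (1 / 2 : ℂ) • eι α (-(i + j)) := by
  have h1 := evenι_mul_oddι (g α) (E i) (f j)
  rwa [show (g α).eo (E i) (f j) = _ from act_E_f i j hij, map_smul] at h1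

theorem Fι_mul_eι (α : ℂ) {i j : Fin 3} (hij : i ≠ j) :
    Fι α i * eι α j - eι α j * Fι α i = (2 : ℂ) • fι α (-(i + j)) := by
  have h1 := evenι_mul_oddι (g α) (F i) (e j)
  rwa [show (g α).eo (F i) (e j) = _ from act_F_e i j hij, map_smul] at h1

/-- The positive root vectors for the base `-βⱼ, α_{j+1}, α_{j+2}`. -/
noncomputable def reflRaise (α : ℂ) (j : Fin 3) : Fin 3 → Env (g α) :=
  ![fι α j, Eι α (j + 1), Eι α (j + 2)]

/-- The negative root vectors for the base `-βⱼ, α_{j+1}, α_{j+2}`. -/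
noncomputable def reflLower (α : ℂ) (j : Fin 3) : Fin 3 → Env (g α) :=
  ![eι α j, Fι α (j + 1), Fι α (j + 2)]

/-- After the odd reflection at `βⱼ` the simple roots are `-βⱼ` and the sums `α_{j+2} = βⱼ +
β_{j+1}`, `α_{j+1} = βⱼ + β_{j+2}`. Differences of distinct simple roots are not roots, so the mixed
brackets vanish. Only the odd pair `fⱼ, eⱼ` anticommutes, which explains the single sign `-1`. -/
theorem triangular_refl (α : ℂ) (j : Fin 3) :
    Triangular (cartanι α) (reflRaise α j) (reflLower α j) ![h α j, H α (j + 1), H α (j + 2)]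
      ![-beta j, evenSimple (j + 1), evenSimple (j + 2)]
      ![![-1, 1, 1], ![1, 1, 1], ![1, 1, 1]] where
  raise_lower := by
    obtain ⟨-, -, -, -, -, -, n1, n2, n3, n4⟩ := fin_three_add j
    have hc := (chevalley_env α).cross j j
    rw [if_pos rfl, add_comm] at hc
    refine forall_fin_three ?_ ?_ ?_ <;> refine forall_fin_three ?_ ?_ ?_ <;>
      simp only [reflRaise, reflLower, Matrix.cons_val]
    · rw [if_pos trivial, ← hc]
      module
    · rw [← Fι_mul_fι α n1]; simp
    · rw [← Fι_mul_fι α n2]; simp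
    · rw [Eι_mul_eι α n1]; simp
    · rw [Eι_mul_Fι]; simp
    · rw [Eι_mul_Fι, if_neg n3]; simp
    · rw [Eι_mul_eι α n2]; simp
    · rw [Eι_mul_Fι, if_neg n4]; simp
    · rw [Eι_mul_Fι]; simp
  weight t := by
    refine forall_fin_three ?_ ?_ ?_ <;> simp only [reflLower, Matrix.cons_val]
    · rw [(chevalley_env α).weight_raise, LinearMap.neg_apply]
      module
    · exact cartanι_mul_Fι α t _
    · exact cartanι_mul_Fι α t _

/-- A grading element for the base `-βⱼ, α_{j+1}, α_{j+2}`. -/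
noncomputable def reflGrading (α : ℂ) (j : Fin 3) : cartan :=
  (2 : ℂ) • H α j + (1 / 2 : ℂ) • H α (j + 1) + (1 / 2 : ℂ) • H α (j + 2)

/-- Since `βⱼ` is `-1` on `Hⱼ` and `1` on the other two coroots, while `αᵢ` is `2` on `Hᵢ` and `0`
on the others, the coefficients `2, 1/2, 1/2` are the only ones with this property. -/
theorem reflGrading_eq_one (α : ℂ) (j a : Fin 3) :
    (![-beta j, evenSimple (j + 1), evenSimple (j + 2)] : Fin 3 → Module.Dual ℂ cartan) a
      (reflGrading α j) = 1 := by
  obtain ⟨-, -, -, -, m1, m2, n1, n2, n3, n4⟩ := fin_three_add j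
  revert a
  refine forall_fin_three ?_ ?_ ?_ <;>
    simp [reflGrading, beta_H, evenSimple_H]
  norm_num

section

variable {α : ℂ} {M : Type*} [AddCommGroup M] [Module ℂ M] [Module (Env (g α)) M]
  [IsScalarTower ℂ (Env (g α)) M]

/-- The root vectors of the reflected base still generate `g`: the missing `e` are multiples of
brackets `[E, fⱼ]` and the missing `f` of brackets `[F, eⱼ]`. -/
theorem smul_mem_of_refl (hα₀ : α ≠ 0) (hα₁ : α ≠ -1) (j : Fin 3) (P : Submodule ℂ M)
    (hx : ∀ a, ∀ m ∈ P, reflRaise α j a • m ∈ P) (hy : ∀ a, ∀ m ∈ P, reflLower α j a • m ∈ P)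
    (u : Env (g α)) : ∀ m ∈ P, u • m ∈ P := by
  obtain ⟨-, -, -, -, -, -, n1, n2, -⟩ := fin_three_add j
  have hf : ∀ m ∈ P, fι α j • m ∈ P := hx 0
  have hE1 : ∀ m ∈ P, Eι α (j + 1) • m ∈ P := hx 1
  have hE2 : ∀ m ∈ P, Eι α (j + 2) • m ∈ P := hx 2
  have he : ∀ m ∈ P, eι α j • m ∈ P := hy 0
  have hF1 : ∀ m ∈ P, Fι α (j + 1) • m ∈ P := hy 1
  have hF2 : ∀ m ∈ P, Fι α (j + 2) • m ∈ P := hy 2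
  have key : ∀ (a b c : Env (g α)) (r : ℂ), r ≠ 0 → a * b - b * a = r • c →
      (∀ m ∈ P, a • m ∈ P) → (∀ m ∈ P, b • m ∈ P) → ∀ m ∈ P, c • m ∈ P := by
    intro a b c r hr habc ha hb m hm
    have h1 : (a * b - b * a) • m ∈ P := by
      rw [sub_smul, mul_smul, mul_smul]
      exact P.sub_mem (ha _ (hb _ hm)) (hb _ (ha _ hm))
    rw [habc, smul_assoc] at h1
    exact (Submodule.smul_mem_iff P hr).1 h1
  have k1 := Eι_mul_fι α n1
  have k2 := Eι_mul_fι α n2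
  have k3 := Fι_mul_eι α n1
  have k4 := Fι_mul_eι α n2
  rw [(third_index j).1] at k1 k3
  rw [(third_index j).2] at k2 k4
  refine env_smul_mem_of_generators hα₀ hα₁ P (fun i => ?_) (fun i => ?_) u
  · rcases fin_three_cases j i with rfl | rfl | rfl
    · exact he
    · exact key _ _ _ _ (by norm_num) k2 hE2 hf
    · exact key _ _ _ _ (by norm_num) k1 hE1 hf
  · rcases fin_three_cases j i with rfl | rfl | rfl
    · exact hf
    · exact key _ _ _ _ (by norm_num) k4 hF2 he
    · exact key _ _ _ _ (by norm_num) k3 hF1 he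

/-- In a simple module, a vector killed by the raising operators whose degree is less than the
degree of some nonzero vector is zero. -/
theorem Triangular.singular_eq_zero {x y : Fin 3 → Env (g α)} {hh : Fin 3 → cartan}
    {wt : Fin 3 → Module.Dual ℂ cartan} {ε : Fin 3 → Fin 3 → ℂ}
    (T : Triangular (cartanι α) x y hh wt ε)
    (hP : ∀ P : Submodule ℂ M, (∀ a, ∀ m ∈ P, x a • m ∈ P) → (∀ a, ∀ m ∈ P, y a • m ∈ P) →
      ∀ u : Env (g α), ∀ m ∈ P, u • m ∈ P)
    (hM : ∀ N : Submodule (Env (g α)) M, N ≠ ⊥ → N = ⊤) {d : cartan} (hd : ∀ a, wt a d = 1)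
    {w : M} (hw : w ≠ 0) {ν : ℂ} (hν : cartanι α d • w = ν • w)
    {s : M} {μ : Module.Dual ℂ cartan} (hs : ∀ t, cartanι α t • s = μ t • s)
    (hx : ∀ a, x a • s = 0) {N : ℕ} (hN : 0 < N) (hμ : ν = μ d + N) : s = 0 := by
  by_contra hs0
  have htop := hM (Submodule.span (Env (g α)) {s}) (by simpa using hs0)
  have hmem : w ∈ Submodule.span (Env (g α)) {s} := htop ▸ Submodule.mem_top
  obtain ⟨u, rfl⟩ := Submodule.mem_span_singleton.1 hmem
  refine hw (T.eq_zero_of_degree hs (d := d) (k := fun _ => 1) (by simpa using hd) ?_ hN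
    (by rw [hν, hμ]))
  exact hP _ (fun a m hm => T.raise_smul_mem_wordSpan hs hx a hm)
    (fun a m hm => lower_smul_mem_wordSpan a hm) u _ (self_mem_wordSpan _ _)

/-- The highest weight vector for the base `-βⱼ, α_{j+1}, α_{j+2}` of a simple module. -/
theorem exists_reflected (hα₀ : α ≠ 0) (hα₁ : α ≠ -1)
    (hM : ∀ N : Submodule (Env (g α)) M, N ≠ ⊥ → N = ⊤) {lam : Module.Dual ℂ cartan} {v : M}
    (hv0 : v ≠ 0) (hv : ∀ i, eι α i • v = 0) (hw : ∀ t, cartanι α t • v = lam t • v)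
    (j : Fin 3) : ∃ (w : M) (μ : Module.Dual ℂ cartan), w ≠ 0 ∧ (∀ a, reflRaise α j a • w = 0) ∧
      (∀ t, cartanι α t • w = μ t • w) ∧
      μ = if lam (h α j) = 0 then lam else lam - beta j := by
  have : SMulCommClass (Env (g α)) ℂ M := IsScalarTower.to_smulCommClass'
  have hE : ∀ i, Eι α i • v = 0 := fun i => E_smul_eq_zero hα₀ hα₁ i (hv _) (hv _)
  have hcr : ∀ i, eι α i • fι α j • v = if i = j then lam (h α i) • v else 0 := fun i => by
    rw [← mul_smul, (chevalley_env α).raise_mul_lower, add_smul, smul_assoc, mul_smul, hv,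
      smul_zero, smul_zero, zero_add]
    split_ifs
    · rw [hw]
    · rw [zero_smul]
  have hwt : ∀ t, cartanι α t • fι α j • v = (lam - beta j) t • fι α j • v := fun t => by
    rw [← mul_smul, (chevalley_env α).weight_lower, sub_smul, mul_smul, hw, smul_comm,
      smul_assoc, ← sub_smul, LinearMap.sub_apply]
  obtain ⟨-, -, -, -, -, -, n1, n2, -⟩ := fin_three_add j
  by_cases hl : lam (h α j) = 0
  -- If `λⱼ = 0`, then `fⱼ v` is killed by all `eᵢ` and has lower degree than `v`. Simplicity makes
  -- it zero, so `v` itself is singular for the reflected base.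
  · have hf : fι α j • v = 0 := by
      refine (chevalley_env α).triangular.singular_eq_zero
        (fun P h1 h2 => env_smul_mem_of_generators hα₀ hα₁ P h1 h2) hM (beta_grading α) hv0
        (hw _) hwt (fun i => ?_) one_pos ?_
      · rw [hcr]
        split_ifs with hij
        · rw [hij, hl, zero_smul]
        · rfl
      · rw [LinearMap.sub_apply, beta_grading]
        simp
    exact ⟨v, lam, hv0, forall_fin_three hf (hE _) (hE _), hw, by rw [if_pos hl]⟩
  -- If `λⱼ ≠ 0`, then `eⱼ fⱼ v = λⱼ v` shows `fⱼ v ≠ 0`. It is killed by `fⱼ`, as `2 fⱼ² = [fⱼ, fⱼ]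
  -- = 0`, and by the other two `Eᵢ`, as `[Eᵢ, fⱼ]` is a multiple of some `eₖ`.
  · refine ⟨fι α j • v, lam - beta j, fun h0 => ?_, ?_, hwt, by rw [if_neg hl]⟩
    · have h1 := hcr j
      rw [h0, smul_zero, if_pos rfl] at h1
      exact (smul_ne_zero hl hv0) h1.symm
    · have key : ∀ i, i ≠ j → Eι α i • fι α j • v = 0 := fun i hij => by
        have h1 := congrArg (fun u => u • v) (Eι_mul_fι α hij)
        simp only [sub_smul, mul_smul, hE, smul_zero, sub_zero, smul_assoc, hv] at h1
        exact h1
      refine forall_fin_three ?_ (key _ n1) (key _ n2)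
      have h1 := congrArg (fun u => u • v) (oddι_mul_oddι (g α) (f j) (f j))
      rw [show (g α).oo (f j) (f j) = 0 from oo_f_self α j, map_zero] at h1
      simp only [zero_smul, ← two_smul ℂ, smul_assoc] at h1
      rw [mul_smul] at h1
      exact (smul_eq_zero.1 h1).resolve_left two_ne_zero

theorem Fι_pow_weight {w : M} {μ : Module.Dual ℂ cartan} (hw : ∀ t, cartanι α t • w = μ t • w)
    (i : Fin 3) (n : ℕ) (t : cartan) :
    cartanι α t • Fι α i ^ n • w = (μ - (n : ℂ) • evenSimple i) t • Fι α i ^ n • w := by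
  have : SMulCommClass (Env (g α)) ℂ M := IsScalarTower.to_smulCommClass'
  induction n with
  | zero => simp [hw]
  | succ n ih =>
    rw [pow_succ', mul_smul, ← mul_smul, cartanι_mul_Fι, sub_smul, mul_smul, ih, smul_comm,
      smul_assoc, ← sub_smul]
    congr 1
    simp
    ring

/-- The standard `sl₂` formula; its scalar vanishes exactly when `μ(Hᵢ) = n`, which links
integrality to nilpotency of `Fᵢ`. -/
theorem Eι_smul_Fι_pow {w : M} {μ : Module.Dual ℂ cartan} (hw : ∀ t, cartanι α t • w = μ t • w)
    (i : Fin 3) (hE : Eι α i • w = 0) (n : ℕ) :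
    Eι α i • Fι α i ^ (n + 1) • w =
      (((n + 1 : ℕ) : ℂ) * (μ (H α i) - n)) • Fι α i ^ n • w := by
  have : SMulCommClass (Env (g α)) ℂ M := IsScalarTower.to_smulCommClass'
  have step : ∀ n, Eι α i • Fι α i ^ (n + 1) • w =
      Fι α i • Eι α i • Fι α i ^ n • w + cartanι α (H α i) • Fι α i ^ n • w := fun n => by
    rw [pow_succ', mul_smul, ← mul_smul, Eι_mul_Fι, if_pos rfl, add_smul, mul_smul]
  induction n with
  | zero =>
    rw [step, pow_zero, one_smul, hE, hw]
    simp
  | succ n ih =>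
    rw [step, ih, Fι_pow_weight hw, smul_comm, ← mul_smul, ← pow_succ', ← add_smul]
    congr 1
    simp [evenSimple_H]
    ring

/-- The vectors on which `Fᵢ` acts nilpotently form a submodule. -/
theorem exists_Fι_pow_smul_eq_zero (hM : ∀ N : Submodule (Env (g α)) M, N ≠ ⊥ → N = ⊤)
    (hα₀ : α ≠ 0) (hα₁ : α ≠ -1) (i : Fin 3) {u : M} (hu : u ≠ 0) (hFu : Fι α i • u = 0) (w : M) :
    ∃ n : ℕ, Fι α i ^ n • w = 0 := by
  have hcomm : SMulCommClass (Env (g α)) ℂ M := IsScalarTower.to_smulCommClass'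
  let P : Submodule ℂ M :=
    { carrier := {m | ∃ n : ℕ, Fι α i ^ n • m = 0}
      zero_mem' := ⟨0, by simp⟩
      add_mem' := by
        rintro a b ⟨n, ha⟩ ⟨k, hb⟩
        refine ⟨n + k, ?_⟩
        rw [smul_add, pow_add, mul_smul _ _ b, hb, smul_zero, add_zero, ← pow_add, add_comm,
          pow_add, mul_smul, ha, smul_zero]
      smul_mem' := by
        rintro c a ⟨n, ha⟩
        exact ⟨n, by rw [smul_comm, ha, smul_zero]⟩ }
  -- `ad Fᵢ` squares to zero on the odd part, so `[Fᵢ, x]` commutes with `Fᵢ` and preserves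
  -- nilpotency. Then `Fᵢ x m = [Fᵢ, x] m + x Fᵢ m` allows induction on the order of nilpotency of
  -- `m`.
  have hodd : ∀ (x : Odd), ∀ m ∈ P, oddι (g α) x • m ∈ P := by
    intro x m ⟨n, hn⟩
    have h1 := evenι_mul_oddι (g α) (F i) x
    have h2 := evenι_mul_oddι (g α) (F i) ((g α).eo (F i) x)
    rw [show (g α).eo (F i) ((g α).eo (F i) x) = 0 from act_F_act_F i x, map_zero,
      sub_eq_zero] at h2
    rw [sub_eq_iff_eq_add] at h1
    induction n generalizing m with
    | zero =>
      rw [pow_zero, one_smul] at hn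
      rw [hn, smul_zero]
      exact P.zero_mem
    | succ n ih =>
      have h3 := ih (Fι α i • m) (by rw [← mul_smul, ← pow_succ, hn])
      have h4 : oddι (g α) ((g α).eo (F i) x) • m ∈ P := by
        refine ⟨n + 1, ?_⟩
        have h5 : Commute (Fι α i) (oddι (g α) ((g α).eo (F i) x)) := h2
        rw [← mul_smul, (h5.pow_left (n + 1)).eq, mul_smul, hn, smul_zero]
      obtain ⟨k, hk⟩ := P.add_mem h4 h3
      refine ⟨k + 1, ?_⟩
      rw [pow_succ, mul_smul, ← mul_smul (Fι α i) (oddι (g α) x), Fι, h1, add_smul, mul_smul]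
      exact hk
  have hP := env_smul_mem_of_generators hα₀ hα₁ P (fun j => hodd _) (fun j => hodd _)
  let N : Submodule (Env (g α)) M :=
    { P with smul_mem' := fun c m hm => hP c m hm }
  have hN : N = ⊤ := hM N fun h0 => hu (by
    have : u ∈ N := ⟨1, by rw [pow_one, hFu]⟩
    rwa [h0, Submodule.mem_bot] at this)
  have : w ∈ N := hN ▸ Submodule.mem_top
  exact this

/-- `F_{j+2}` acts injectively on a simple module unless its highest weight for the base
`-βⱼ, α_{j+1}, α_{j+2}` takes a nonnegative integral value on the coroot. -/
theorem injective_iff_of_reflected (hα₀ : α ≠ 0) (hα₁ : α ≠ -1)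
    (hM : ∀ N : Submodule (Env (g α)) M, N ≠ ⊥ → N = ⊤) {j i : Fin 3} (hi : i = j + 2) {w : M}
    {μ : Module.Dual ℂ cartan} (hw0 : w ≠ 0) (hx : ∀ a, reflRaise α j a • w = 0)
    (hw : ∀ t, cartanι α t • w = μ t • w) :
    (Function.Injective fun m : M => Fι α i • m) ↔ ¬ ∃ n : ℕ, μ (H α i) = n := by
  obtain ⟨-, -, -, -, -, -, n1, n2, n3, n4⟩ := fin_three_add j
  subst hi
  have hE : Eι α (j + 2) • w = 0 := hx 2
  constructor
  · rintro hinj ⟨n, hn⟩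
    have hpow : ∀ k : ℕ, Fι α (j + 2) ^ k • w = 0 → w = 0 := by
      intro k
      induction k with
      | zero => simp
      | succ k ih =>
        intro hk
        rw [pow_succ', mul_smul] at hk
        exact ih (hinj (by simpa using hk))
    -- If `μ(Hᵢ) = n`, then `Fᵢ^(n+1) w` is singular for the reflected base and lies `n + 1` degrees
    -- below `w`. So it is zero by simplicity, contradicting injectivity.
    refine hw0 (hpow (n + 1) ?_)
    refine (triangular_refl α j).singular_eq_zero
      (fun P h1 h2 => smul_mem_of_refl hα₀ hα₁ j P h1 h2) hM (reflGrading_eq_one α j) hw0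
      (hw _) (Fι_pow_weight hw (j + 2) (n + 1)) ?_ (Nat.succ_pos n) ?_
    · have hcomm : ∀ a, Commute a (Fι α (j + 2)) → a • w = 0 →
          a • Fι α (j + 2) ^ (n + 1) • w = 0 := by
        intro a ha haw
        rw [← mul_smul, (ha.pow_right (n + 1)).eq, mul_smul, haw, smul_zero]
      refine forall_fin_three (hcomm _ (Fι_mul_fι α n2).symm (hx 0)) (hcomm _ ?_ (hx 1)) ?_
      · have := Eι_mul_Fι α (j + 1) (j + 2)
        rwa [if_neg n3, add_zero] at this
      · change Eι α (j + 2) • _ = _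
        rw [Eι_smul_Fι_pow hw _ hE, hn]
        simp
    · have := reflGrading_eq_one α j 2
      simp only [Matrix.cons_val] at this
      simp [this]
  · intro hn
    by_contra hinj
    obtain ⟨u, hu, hFu⟩ : ∃ u : M, u ≠ 0 ∧ Fι α (j + 2) • u = 0 := by
      by_contra! hcon
      refine hinj fun a b hab => ?_
      by_contra hne
      refine hcon (a - b) (sub_ne_zero.2 hne) ?_
      rw [smul_sub, sub_eq_zero]
      exact hab
    classical
    -- A nonzero kernel makes `Fᵢ` locally nilpotent on the simple module. With `n + 1` the least
    -- exponent killing `w`, applying `Eᵢ` gives `(n + 1)(μ(Hᵢ) - n) = 0`.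
    obtain ⟨k, hk, hkmin⟩ := Nat.findX (exists_Fι_pow_smul_eq_zero hM hα₀ hα₁ (j + 2) hu hFu w)
    cases k with
    | zero => exact hw0 (by simpa using hk)
    | succ n =>
      have h1 := Eι_smul_Fι_pow hw _ hE n
      rw [hk, smul_zero] at h1
      rcases smul_eq_zero.1 h1.symm with h2 | h2
      · rcases mul_eq_zero.1 h2 with h3 | h3
        · exact Nat.cast_ne_zero.2 (Nat.succ_ne_zero n) h3
        · exact hn ⟨n, sub_eq_zero.1 h3⟩
      · exact hkmin n (Nat.lt_succ_self n) h2

end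

end D21

/-! ### The criterion in terms of `λᵢ` and `cᵢ`; even roots and their root spaces. -/

namespace D21

open LieSuperalgebra

section

variable {α : ℂ} {M : Type*} [AddCommGroup M] [Module ℂ M] [Module (Env (g α)) M]
  [IsScalarTower ℂ (Env (g α)) M]

theorem h_add_h (α : ℂ) (i : Fin 3) :
    h α (i + 1) + h α (i + 2) = sigma α i • H α i := by
  obtain ⟨h0, h1, h2⟩ := h_eq α
  revert i
  refine forall_fin_three ?_ ?_ ?_ <;> simp [h0, h1, h2] <;> module

/-- The reflection is made at `j = i + 1`, so that `αᵢ = α_{j+2}` becomes simple. -/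
theorem injective_iff (hα₀ : α ≠ 0) (hα₁ : α ≠ -1)
    (hM : ∀ N : Submodule (Env (g α)) M, N ≠ ⊥ → N = ⊤) {lam : Module.Dual ℂ cartan} {v : M}
    (hv0 : v ≠ 0) (hv : ∀ i, eι α i • v = 0) (hw : ∀ t, cartanι α t • v = lam t • v)
    (i : Fin 3) : (Function.Injective fun m : M => Fι α i • m) ↔
      (¬ ∃ n : ℤ, 1 ≤ n ∧ lam (H α i) = n) ∧
        ¬ (lam (h α (i + 1)) = 0 ∧ lam (h α (i + 2)) = 0) := by
  obtain ⟨-, a2, -, -, -, -, n1, -⟩ := fin_three_add i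
  obtain ⟨w, μ, hw0, hx, hwt, hμ⟩ := exists_reflected hα₀ hα₁ hM hv0 hv hw (i + 1)
  rw [injective_iff_of_reflected hα₀ hα₁ hM a2.symm hw0 hx hwt, ← not_or, not_iff_not]
  have hsum : lam (h α (i + 1)) + lam (h α (i + 2)) = sigma α i * lam (H α i) := by
    rw [← map_add, h_add_h, map_smul, smul_eq_mul]
  -- If `λ_{i+1} = 0`, the weight is unchanged and `λ_{i+2} = σᵢ cᵢ`. The value `cᵢ = 0` is then the
  -- case of two vanishing labels. Otherwise `β_{i+1}(Hᵢ) = 1` replaces `cᵢ` by `cᵢ - 1`, which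
  -- turns `ℤ_{≥0}` into `ℤ_{≥1}`.
  by_cases hl : lam (h α (i + 1)) = 0
  · rw [hμ, if_pos hl]
    rw [hl, zero_add] at hsum
    constructor
    · rintro ⟨n, hn⟩
      cases n with
      | zero => exact Or.inr ⟨hl, by rw [hsum, hn]; simp⟩
      | succ n => exact Or.inl ⟨n + 1, by omega, by rw [hn]; push_cast; rfl⟩
    · rintro (⟨n, hn, hn'⟩ | ⟨-, h2⟩)
      · lift n to ℕ using by omega
        exact ⟨n, by simpa using hn'⟩
      · refine ⟨0, ?_⟩
        rw [h2] at hsum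
        simpa [sigma_ne_zero hα₀ hα₁ i] using hsum.symm
  · rw [hμ, if_neg hl, LinearMap.sub_apply, beta_H, if_neg n1]
    constructor
    · rintro ⟨n, hn⟩
      exact Or.inl ⟨n + 1, by omega, by push_cast; linear_combination hn⟩
    · rintro (⟨n, hn, hn'⟩ | ⟨h1, -⟩)
      · lift n to ℕ using by omega
        refine ⟨n - 1, ?_⟩
        rw [hn', Nat.cast_sub (by omega)]
        simp
      · exact absurd h1 hl

theorem evenPos_eq_range : evenPos = Set.range evenSimple := by
  ext γ
  constructor
  · rintro (rfl | rfl | rfl)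
    exacts [⟨2, rfl⟩, ⟨1, rfl⟩, ⟨0, rfl⟩]
  · rintro ⟨i, rfl⟩
    revert i
    refine forall_fin_three ?_ ?_ ?_ <;> simp [evenPos, evenSimple]

theorem mem_evenNeg {γ : Module.Dual ℂ cartan} : γ ∈ evenNeg ↔ ∃ i, γ = -evenSimple i := by
  rw [evenNeg, Set.mem_ofPred_eq, evenPos_eq_range]
  constructor
  · rintro ⟨i, hi⟩
    exact ⟨i, by rw [hi, neg_neg]⟩
  · rintro ⟨i, rfl⟩
    exact ⟨i, by rw [neg_neg]⟩

theorem evenRootSpace_entry {γ : Module.Dual ℂ cartan} {x : Even}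
    (hx : x ∈ evenRootSpace (g α) cartan γ) (t : cartan) (j : Fin 3) :
    γ t * (x j).1 0 0 = 0 ∧ γ t * (x j).1 0 1 = evenSimple j t * (x j).1 0 1 ∧
      γ t * (x j).1 1 0 = -evenSimple j t * (x j).1 1 0 := by
  have h1 : ∀ a b, (evenBracketₗ t.1 x j).1 a b = γ t * (x j).1 a b := fun a b => by
    rw [show evenBracketₗ t.1 x = γ t • x from hx t, smul_entry]
  have k0 := (t.2 j).1
  have k1 := (t.2 j).2
  rw [← h1, ← h1, ← h1, evenSimple_apply]
  simp only [evenBracket_apply, trace_zero, k0, k1]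
  refine ⟨?_, ?_, ?_⟩ <;> ring

/-- The matrix entries of an even element have weights `0` and `±αⱼ`. A root vector has a nonzero
entry, and `γ ≠ 0` rules out the diagonal ones. -/
theorem eq_evenSimple_of_mem_evenRoots {γ : Module.Dual ℂ cartan}
    (hγ : γ ∈ evenRoots (g α) cartan) : ∃ i, γ = evenSimple i ∨ γ = -evenSimple i := by
  obtain ⟨h0, h1⟩ := hγ
  obtain ⟨x, hx, hx0⟩ := Submodule.exists_mem_ne_zero_of_ne_bot h1
  by_contra! hcon
  have key : ∀ (z : ℂ) (δ : Module.Dual ℂ cartan), γ ≠ δ → (∀ t, γ t * z = δ t * z) → z = 0 := by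
    intro z δ hne hz
    by_contra hz0
    exact hne (LinearMap.ext fun t => mul_right_cancel₀ hz0 (hz t))
  refine hx0 (even_ext (fun j => ?_) (fun j => ?_) (fun j => ?_))
  · exact key _ 0 h0 fun t => by rw [(evenRootSpace_entry hx t j).1]; simp
  · exact key _ _ (hcon j).1 fun t => (evenRootSpace_entry hx t j).2.1
  · exact key _ _ (hcon j).2 fun t => (evenRootSpace_entry hx t j).2.2

theorem E_ne_zero (i : Fin 3) : E i ≠ 0 := fun h0 => by
  have := E_apply i i 0 1
  rw [h0] at this
  simp at this

theorem F_ne_zero (i : Fin 3) : F i ≠ 0 := fun h0 => by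
  have := F_apply i i 1 0
  rw [h0] at this
  simp at this

theorem neg_evenSimple_mem_evenRoots (α : ℂ) (i : Fin 3) :
    -evenSimple i ∈ evenRoots (g α) cartan := by
  refine ⟨fun h0 => ?_, fun h0 => F_ne_zero i ?_⟩
  · have := LinearMap.congr_fun h0 (H α i)
    rw [LinearMap.neg_apply, evenSimple_H, if_pos rfl] at this
    simp at this
  · have := (sl2_triple α i).2.1
    rwa [h0, Submodule.mem_bot] at this

theorem eq_smul_F {i : Fin 3} {x : Even} (hx : x ∈ evenRootSpace (g α) cartan (-evenSimple i)) :
    x = (x i).1 1 0 • F i := by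
  have h1 := evenRootSpace_entry hx
  apply even_ext <;> intro j <;> rw [smul_entry, F_apply]
  · have := (h1 (H α i) j).1
    rw [LinearMap.neg_apply, evenSimple_H, if_pos rfl] at this
    simpa using this
  -- On `Hᵢ + Hⱼ` the weight `-αᵢ` is negative and `αⱼ` is positive, whether or not `i = j`, so the
  -- upper entry must vanish.
  · have := (h1 (H α i + H α j) j).2.1
    simp only [LinearMap.neg_apply, map_add, evenSimple_H] at this
    by_cases hij : j = i
    · subst hij
      simp only [if_true] at this
      simp only [zero_ne_one, false_and, and_false, if_false, mul_zero]
      linear_combination (-1 / 8) * this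
    · simp only [if_true, if_neg hij, if_neg (Ne.symm hij)] at this
      simp only [zero_ne_one, false_and, and_false, if_false, mul_zero]
      linear_combination (-1 / 4) * this
  · by_cases hij : j = i
    · subst hij
      simp
    · have := (h1 (H α i) j).2.2
      simp only [LinearMap.neg_apply, evenSimple_H, if_true, if_neg hij] at this
      simp only [hij, false_and, if_false, mul_zero]
      linear_combination (-1 / 2) * this

/-- The roots `αᵢ` never belong to `inj M`, because `Eᵢ v = 0` with `v ≠ 0`. For `-αᵢ` it suffices
to test `Fᵢ`, which spans the root space. -/
theorem inj_eq_evenNeg_iff (hα₀ : α ≠ 0) (hα₁ : α ≠ -1) {v : M} (hv0 : v ≠ 0)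
    (hv : ∀ i, eι α i • v = 0) : inj (g α) cartan M = evenNeg ↔
      ∀ i, Function.Injective fun m : M => Fι α i • m := by
  constructor
  · intro h0 i
    have h1 : -evenSimple i ∈ inj (g α) cartan M := h0 ▸ mem_evenNeg.2 ⟨i, rfl⟩
    exact h1.2 (F i) (sl2_triple α i).2.1 (F_ne_zero i)
  · intro hF
    ext γ
    rw [mem_evenNeg]
    constructor
    · rintro ⟨h1, h2⟩
      obtain ⟨i, rfl | rfl⟩ := eq_evenSimple_of_mem_evenRoots h1
      · refine absurd (h2 (E i) (sl2_triple α i).1 (E_ne_zero i) ?_) hv0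
        change evenι (g α) (E i) • v = evenι (g α) (E i) • (0 : M)
        rw [smul_zero, E_smul_eq_zero hα₀ hα₁ i (hv _) (hv _)]
      · exact ⟨i, rfl⟩
    · rintro ⟨i, rfl⟩
      refine ⟨neg_evenSimple_mem_evenRoots α i, fun x hx hx0 m n hmn => hF i ?_⟩
      have h1 := eq_smul_F hx
      have hc : (x i).1 1 0 ≠ 0 := fun h0 => hx0 (by rw [h1, h0, zero_smul])
      change evenι (g α) x • m = evenι (g α) x • n at hmn
      rw [h1, map_smul, smul_assoc, smul_assoc] at hmn
      exact smul_right_injective M hc hmn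

end

end D21

theorem mainTheorem6 (α : ℂ) (hα₀ : α ≠ 0) (hα₁ : α ≠ -1) (lam : Module.Dual ℂ D21.cartan)
    (l c : Fin 3 → ℂ) (hl : ∀ i, l i = lam (D21.h α i)) (hc : ∀ i, c i = lam (D21.H α i)) :
    (c 0 = (l 1 + l 2) / (-α - 1) ∧ c 1 = (l 0 + l 2) / α ∧ c 2 = l 0 + l 1) ∧
    (LieSuperalgebra.inj (D21.g α) D21.cartan
        (LieSuperalgebra.SimpleHW (D21.g α) D21.cartan D21.pos lam) = D21.evenNeg ↔
      (∀ i, ¬ ∃ n : ℤ, 1 ≤ n ∧ c i = n) ∧ (∀ i j, l i = 0 → l j = 0 → i = j)) := by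
  constructor
  · have hs : ∀ i, l (i + 1) + l (i + 2) = D21.sigma α i * c i := fun i => by
      rw [hl, hl, hc, ← map_add, D21.h_add_h, map_smul, smul_eq_mul]
    have h0 : l 1 + l 2 = -(α + 1) * c 0 := hs 0
    have h1 : l 2 + l 0 = α * c 1 := hs 1
    have h2 : l 0 + l 1 = 1 * c 2 := hs 2
    have hα₁' : -α - 1 ≠ 0 := fun hh => hα₁ (by linear_combination -hh)
    refine ⟨?_, ?_, ?_⟩
    · rw [eq_div_iff hα₁']
      linear_combination -h0
    · rw [eq_div_iff hα₀]
      linear_combination -h1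
    · linear_combination -h2
  · have hv0 := D21.simpleVec_ne_zero lam hα₀ hα₁
    rw [D21.inj_eq_evenNeg_iff hα₀ hα₁ hv0 (D21.eι_smul_simpleVec lam)]
    have key := D21.injective_iff hα₀ hα₁ (fun N hN => D21.simpleHW_eq_top lam hN) hv0
      (D21.eι_smul_simpleVec lam) (D21.cartanι_smul_simpleVec lam)
    simp only [key, ← hl, ← hc, forall_and]
    -- Two distinct indices `i`, `j` with vanishing labels are the complement of `-(i + j)`, and the
    -- condition attached to that index excludes them.
    refine and_congr_right fun _ => ⟨fun h i j hi hj => ?_, fun h i hi => ?_⟩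
    · by_contra hij
      rcases D21.third_index_cases i j hij with ⟨h1, h2⟩ | ⟨h1, h2⟩
      · exact h (-(i + j)) ⟨by rw [h1, hi], by rw [h2, hj]⟩
      · exact h (-(i + j)) ⟨by rw [h1, hj], by rw [h2, hi]⟩
    · exact (D21.fin_three_add i).2.2.2.2.2.2.2.2.1 (h _ _ hi.1 hi.2)
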